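/- **Conventions.** Baire space is $\mathbb N^{\mathbb N}$ with the product topology. A representation of a set $X$ is a surjective partial function $\delta_X:\subseteq\mathbb N^{\mathbb N}\to X$. A partial function $F:\subseteq\mathbb N^{\mathbb N}\to\mathbb N^{\mathbb N}$ is computable if a Type-2 machine computes $F(p)$ from $p$ for every $p\in\mathrm{dom}(F)$. A multi-valued partial function $f:\subseteq X\rightrightarrows Y$ assigns to each $x\in X$ a set $f(x)\subseteq Y$, and $\mathrm{dom}(f)=\{x: f(x)\neq\emptyset\}$. A realizer of $f$ with respect to $(\delta_X,\delta_Y)$ is a partial function $F:\subseteq\mathbb N^{\mathbb N}\to\mathbb N^{\mathbb N}$ such that $\delta_Y(F(p))$ is defined and lies in $f(\delta_X(p))$ for all $p\in\mathrm{dom}(\delta_X)$ with $\delta_X(p)\in\mathrm{dom}(f)$; $f$ is $(\delta_X,\delta_Y)$-computable if it has a computable realizer. For multi-valued functions $f,g$ on represented spaces, $f\leq_{\mathrm{sW}}g$ means that there are computable $H,K:\subseteq\mathbb N^{\mathbb N}\to\mathbb N^{\mathbb N}$ such that $H\circ G\circ K$ is a realizer of $f$ for every realizer $G$ of $g$. Let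 $\lim:\subseteq\mathbb N^{\mathbb N}\to\mathbb N^{\mathbb N}$, $\langle p_0,p_1,\dots\rangle\mapsto\lim_{i\to\infty}p_i$, where $\langle p_0,p_1,\dots\rangle(\langle i,j\rangle)=p_i(j)$. Let $(U_n)_n$ be the standard enumeration of the c.e. open subsets of $\mathbb N^{\mathbb N}$, and let $J:\mathbb N^{\mathbb N}\to\mathbb N^{\mathbb N}$ be the Turing jump: $J(p)(n)=1$ if $p\in U_n$ and $J(p)(n)=0$ otherwise. $J$ is injective; $J^{-1}$ is its partial inverse, and $\mathsf L:=J^{-1}\circ\lim$, a partial function on $\mathbb N^{\mathbb N}$ represented by the identity. For a representation $\delta$ of $X$ let $\delta^\vee:=\delta\circ J^{-1}\circ\lim$, which is again a representation of $X$. Call $f:\subseteq X\rightrightarrows Y$ low computable if it is $(\delta_X,\delta_Y^\vee)$-computable. For a represented space $(X,\delta)$, call $A\subseteq X$ closed if the characteristic function of $X\setminus A$, as a map into Sierpiński space, has a continuous realizer; here $p$ is a name of $1$ in Sierpiński space if $p(n)=0$ for some $n$, and a name of $0$ otherwise. A negative-information name of $A$ is a name of this characteristic function in the canonical function space representation. Closed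 choice $\mathsf C_X$ is the multi-valued map $A\mapsto A$ from the closed subsets with negative information to $X$, with domain the non-empty closed subsets. A computable metric space is a metric space with a dense sequence $(\alpha_i)_i$ such that $(i,j)\mapsto d(\alpha_i,\alpha_j)$ is a computable double sequence of reals. It is represented by its Cauchy representation: $p$ is a name of $x$ if $d(\alpha_{p(i)},\alpha_{p(j)})<2^{-j}$ for all $i>j$ and $\alpha_{p(n)}\to x$. It is a computable $K_\sigma$-space if it is the union of a sequence $(K_i)_i$ of non-empty compact subsets for which there is a computable sequence $(p_i)_i$ such that each $p_i$ lists exactly the finite covers of $K_i$ by rational open balls all of which meet $K_i$. **Theorem.** (1) Let $(X,\delta_X)$ and $(Y,\delta_Y)$ be represented spaces and let $f:\subseteq X\rightrightarrows Y$ be a multi-valued function. Then $f$ is low computable if and only if $f\leq_{\mathrm{sW}}\mathsf L$. (2) For every computable $K_\sigma$-space $X$, closed choice $\mathsf C_X$ is low computable. -/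

import Mathlib

open Topology Filter

universe u v w

noncomputable section

namespace TTE

/-! ### Partial functions on Baire space -/

/-- Baire space `ℕ^ℕ`, with the product topology. -/
abbrev Baire : Type := ℕ → ℕ

/-- The prefix `p(0) ... p(k-1)` of length `k`. -/
def pre (p : Baire) (k : ℕ) : List ℕ := (List.range k).map p

/-- Computability of a partial function on Baire space: there is a computable, prefix-monotone
function `φ` on finite words (`φ w` is what a Type-2 machine has written on its one-way output tape
by the time it has processed the input prefix `w`) such that, for every `p` in the domain of `F`,
the words `φ (pre p k)` are prefixes of `F p` of unbounded length. -/
def ComputablePFun (F : Baire →. Baire) : Prop :=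
  ∃ φ : List ℕ → List ℕ, Computable φ ∧ (∀ u v, u <+: v → φ u <+: φ v) ∧
    ∀ p, ∀ q ∈ F p, (∀ k, φ (pre p k) = pre q (φ (pre p k)).length) ∧
      ∀ n, ∃ k, n ≤ (φ (pre p k)).length

/-- The partial function with graph `R` (used only for single-valued relations `R`). -/
def ofRel {α : Type*} {β : Type*} (R : α → β → Prop) : α →. β :=
  fun a => ⟨∃ b, R a b, fun h => h.choose⟩

theorem mem_ofRel {α : Type*} {β : Type*} {R : α → β → Prop}
    (hR : ∀ a b b', R a b → R a b' → b = b') (a : α) (b : β) : b ∈ ofRel R a ↔ R a b := by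
  constructor
  · rintro ⟨h, rfl⟩
    exact h.choose_spec
  · intro h
    exact ⟨⟨b, h⟩, hR a _ _ (Exists.choose_spec (⟨b, h⟩ : ∃ b, R a b)) h⟩

/-! ### Representations, realizers, strong Weihrauch reducibility -/

/-- A representation of `X`: a surjective partial function from Baire space to `X`. -/
structure Representation (X : Type u) where
  toPFun : Baire →. X
  surj : ∀ x, ∃ p, x ∈ toPFun p

/-- The identity as representation of Baire space. -/
def baireRep : Representation Baire where
  toPFun := PFun.id Baire
  surj := fun p => ⟨p, Part.mem_some p⟩

/-- `F` is a realizer of the multi-valued partial function `f` from `X` to `Y`. A multi-valued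
partial function is given by its sets of values; its domain is `{x | (f x).Nonempty}`. -/
def Realizes {X : Type u} {Y : Type v} (δX : Representation X) (δY : Representation Y)
    (F : Baire →. Baire) (f : X → Set Y) : Prop :=
  ∀ p, ∀ x ∈ δX.toPFun p, (f x).Nonempty → ∃ q ∈ F p, ∃ y ∈ δY.toPFun q, y ∈ f x

/-- `f` is `(δX, δY)`-computable. -/
def ComputableMV {X : Type u} {Y : Type v} (δX : Representation X) (δY : Representation Y)
    (f : X → Set Y) : Prop :=
  ∃ F : Baire →. Baire, ComputablePFun F ∧ Realizes δX δY F f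

/-- Strong Weihrauch reducibility `f ≤_sW g`. -/
def StrongWeihrauchLE {X : Type*} {Y : Type*} {U : Type*} {V : Type*}
    (δX : Representation X) (δY : Representation Y) (f : X → Set Y)
    (δU : Representation U) (δV : Representation V) (g : U → Set V) : Prop :=
  ∃ H K : Baire →. Baire, ComputablePFun H ∧ ComputablePFun K ∧
    ∀ G : Baire →. Baire, Realizes δU δV G g → Realizes δX δY (H.comp (G.comp K)) f

/-! ### The limit map and the Turing jump -/

/-- `lim ⟨p₀, p₁, ...⟩ = lim pᵢ`, where `⟨p₀, p₁, ...⟩ ⟨i, j⟩ = pᵢ j`. -/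
def limMap : Baire →. Baire :=
  ofRel fun p q => Tendsto (fun i j => p (Nat.pair i j)) atTop (𝓝 q)

theorem mem_limMap (p q : Baire) :
    q ∈ limMap p ↔ Tendsto (fun i j => p (Nat.pair i j)) atTop (𝓝 q) :=
  mem_ofRel (fun _ _ _ h h' => tendsto_nhds_unique h h') p q

/-- The standard enumeration of the c.e. open subsets of Baire space: `U n` is the union of the
cylinders `w ℕ^ℕ` of all words `w` in the domain of the `n`-th partial recursive function. -/
def ceOpen (n : ℕ) : Set Baire :=
  {p | ∃ k, ((Nat.Partrec.Code.ofNatCode n).eval (Encodable.encode (pre p k))).Dom}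

open Classical in
/-- The Turing jump on Baire space. -/
def jump (p : Baire) : Baire := fun n => if p ∈ ceOpen n then 1 else 0

theorem pre_injOn {p q : Baire} {k l : ℕ} (h : pre p k = pre q l) :
    k = l ∧ ∀ i < k, p i = q i := by
  have hkl : k = l := by simpa [pre] using congrArg List.length h
  subst hkl
  refine ⟨rfl, fun i hi => ?_⟩
  simpa [pre] using List.map_inj_left.1 h i (List.mem_range.2 hi)

theorem exists_ceOpen (a : List ℕ) : ∃ n, ceOpen n = {p | ∃ k, pre p k = a} := by
  have hp : Nat.Partrec fun m =>
      Nat.rfind fun _ => Part.some (decide (m = Encodable.encode a)) := by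
    have : Partrec fun m : ℕ =>
        Nat.rfind fun _ => Part.some (decide (m = Encodable.encode a)) := by
      refine Partrec.rfind (p := fun m _ => Part.some (decide (m = Encodable.encode a))) ?_
      have h1 : PrimrecPred fun m : ℕ => m = Encodable.encode a :=
        Primrec.eq.comp Primrec.id (Primrec.const _)
      exact (h1.decide.to_comp.comp Computable.fst).partrec
    exact Partrec.nat_iff.1 this
  obtain ⟨c, hc⟩ := Nat.Partrec.Code.exists_code.1 hp
  refine ⟨Nat.Partrec.Code.encodeCode c, ?_⟩
  have hcode : Nat.Partrec.Code.ofNatCode (Nat.Partrec.Code.encodeCode c) = c :=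
    Denumerable.ofNat_encode c
  ext p
  simp only [ceOpen, hcode, hc, Set.mem_ofPred_eq]
  refine exists_congr fun k => (Nat.rfind_dom (p := (fun _ => Part.some
    (decide (Encodable.encode (pre p k) = Encodable.encode a)) : ℕ →. Bool))).trans ?_
  simp

theorem jump_injective : Function.Injective jump := by
  intro p q h
  funext i
  obtain ⟨n, hn⟩ := exists_ceOpen (pre p (i + 1))
  have h1 : p ∈ ceOpen n := by rw [hn]; exact ⟨_, rfl⟩
  have h2 := congrFun h n
  simp only [jump, h1, if_true] at h2
  have h3 : q ∈ ceOpen n := by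
    by_contra hq
    simp [hq] at h2
  rw [hn] at h3
  obtain ⟨k, hk⟩ := h3
  obtain ⟨rfl, hk⟩ := pre_injOn hk
  exact (hk i (Nat.lt_succ_self i)).symm

/-- The inverse of the Turing jump, a partial function with domain the range of the jump. -/
def jumpInv : Baire →. Baire := ofRel fun q p => jump p = q

theorem mem_jumpInv (p q : Baire) : p ∈ jumpInv q ↔ jump p = q :=
  mem_ofRel (fun _ _ _ h h' => jump_injective (h.trans h'.symm)) q p

/-- `L = J⁻¹ ∘ lim`. -/
def lowPFun : Baire →. Baire := jumpInv.comp limMap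

/-- `L` as a (single-valued) instance of a multi-valued function. -/
def lowMap : Baire → Set Baire := fun p => {q | q ∈ lowPFun p}

/-- The integral `∫ δ = δ ∘ J⁻¹`. -/
def Representation.integral {X : Type u} (δ : Representation X) : Representation X where
  toPFun := δ.toPFun.comp jumpInv
  surj := by
    intro x
    obtain ⟨p, hp⟩ := δ.surj x
    exact ⟨jump p, Part.mem_bind_iff.2 ⟨p, (mem_jumpInv p _).2 rfl, hp⟩⟩

/-- The derivative `δ' = δ ∘ lim`. -/
def Representation.derivative {X : Type u} (δ : Representation X) : Representation X where
  toPFun := δ.toPFun.comp limMap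
  surj := by
    intro x
    obtain ⟨p, hp⟩ := δ.surj x
    refine ⟨fun n => p n.unpair.2, Part.mem_bind_iff.2 ⟨p, (mem_limMap _ p).2 ?_, hp⟩⟩
    simp

/-- The low representation `δ^∨ = (∫ δ)'`. -/
def Representation.low {X : Type u} (δ : Representation X) : Representation X :=
  δ.integral.derivative

/-- `f` is low computable. -/
def LowComputable {X : Type u} {Y : Type v} (δX : Representation X) (δY : Representation Y)
    (f : X → Set Y) : Prop :=
  ComputableMV δX δY.low f

/-! ### Function spaces, closed sets with negative information, closed choice -/

/-- The partial continuous function on Baire space with associate `p`: the value `m` at place `n`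
is found by applying `p` to `n` and longer and longer prefixes of the input until `p` answers
`m + 1` (the answer `0` asks for a longer prefix). -/
def assoc (p : Baire) : Baire →. Baire := fun q =>
  ⟨∀ n, ∃ k, p (Nat.pair n (Encodable.encode (pre q k))) ≠ 0,
    fun h n => p (Nat.pair n (Encodable.encode (pre q (Nat.find (h n))))) - 1⟩

/-- `f` is continuous with respect to the representations: it has a continuous realizer. -/
def RepContinuous {X : Type u} {Y : Type v} (δX : Representation X) (δY : Representation Y)
    (f : X → Y) : Prop :=
  ∃ F : Baire →. Baire, Continuous F.asSubtype ∧ Realizes δX δY F fun x => {f x}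

/-- Every continuous partial function on Baire space is extended by one that has an associate. -/
theorem exists_assoc (F : Baire →. Baire) (hF : Continuous F.asSubtype) :
    ∃ p, ∀ q, ∀ r ∈ F q, r ∈ assoc p q := by
  classical
  let P : ℕ → List ℕ → ℕ → Prop := fun n w m =>
    (∃ q, ∃ r ∈ F q, w = pre q w.length ∧ r n = m) ∧
      ∀ q, ∀ r ∈ F q, w = pre q w.length → r n = m
  let p : Baire := fun c =>
    if h : ∃ w : List ℕ, Encodable.encode w = c.unpair.2 ∧ ∃ m, P c.unpair.1 w m
    then h.choose_spec.2.choose + 1 else 0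
  have hp : ∀ n w, p (Nat.pair n (Encodable.encode w)) ≠ 0 →
      P n w (p (Nat.pair n (Encodable.encode w)) - 1) := by
    intro n w h
    by_cases hw : ∃ w' : List ℕ, Encodable.encode w' = (Nat.pair n (Encodable.encode w)).unpair.2 ∧
        ∃ m, P (Nat.pair n (Encodable.encode w)).unpair.1 w' m
    · have e : p (Nat.pair n (Encodable.encode w)) = hw.choose_spec.2.choose + 1 := dif_pos hw
      have h1 := hw.choose_spec.1
      have h2 := hw.choose_spec.2.choose_spec
      rw [e, Nat.add_sub_cancel]
      have h3 : hw.choose = w := by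
        apply Encodable.encode_injective
        rw [h1, Nat.unpair_pair]
      have h4 : (Nat.pair n (Encodable.encode w)).unpair.1 = n := by rw [Nat.unpair_pair]
      generalize hw.choose_spec.2.choose = m at h2
      rw [h3, h4] at h2
      exact h2
    · exact absurd (dif_neg hw) h
  have hp' : ∀ n w m, P n w m → p (Nat.pair n (Encodable.encode w)) ≠ 0 := by
    intro n w m h
    have hw : ∃ w' : List ℕ, Encodable.encode w' = (Nat.pair n (Encodable.encode w)).unpair.2 ∧
        ∃ m, P (Nat.pair n (Encodable.encode w)).unpair.1 w' m := by
      refine ⟨w, ?_, m, ?_⟩ <;> rw [Nat.unpair_pair]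
      exact h
    have e : p (Nat.pair n (Encodable.encode w)) = hw.choose_spec.2.choose + 1 := dif_pos hw
    rw [e]
    exact Nat.succ_ne_zero _
  have hlen : ∀ (q : Baire) k, (pre q k).length = k := by intro q k; simp [pre]
  refine ⟨p, fun q r hr => ?_⟩
  have key : ∀ n, ∃ k, p (Nat.pair n (Encodable.encode (pre q k))) ≠ 0 := by
    intro n
    obtain ⟨hq, rfl⟩ := hr
    have hc : Continuous fun z : F.Dom => F.asSubtype z n := (continuous_apply n).comp hF
    have ho : IsOpen {z : F.Dom | F.asSubtype z n = (F q).get hq n} :=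
      (isOpen_discrete {(F q).get hq n}).preimage hc
    obtain ⟨O, hO, hOe⟩ := isOpen_induced_iff.1 ho
    have hqO : q ∈ O := by
      have : (⟨q, hq⟩ : F.Dom) ∈ Subtype.val ⁻¹' O := by rw [hOe]; rfl
      exact this
    obtain ⟨I, V, hV, hVO⟩ := isOpen_pi_iff.1 hO q hqO
    refine ⟨I.sup id + 1, hp' n _ ((F q).get hq n)
      ⟨⟨q, _, ⟨hq, rfl⟩, by rw [hlen], rfl⟩, ?_⟩⟩
    rintro q' r' ⟨hq', rfl⟩ hpre
    rw [hlen] at hpre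
    have hag := (pre_injOn hpre).2
    have hq'O : q' ∈ O := by
      apply hVO
      intro i hi
      have hi' : i < I.sup id + 1 := Nat.lt_succ_of_le (Finset.le_sup (f := id) hi)
      rw [← hag i hi']
      exact (hV i hi).2
    have : (⟨q', hq'⟩ : F.Dom) ∈ {z : F.Dom | F.asSubtype z n = (F q).get hq n} := by
      rw [← hOe]; exact hq'O
    exact this
  refine ⟨key, ?_⟩
  funext n
  have h := hp n _ (Nat.find_spec (key n))
  exact (h.2 q r hr (by rw [hlen])).symm

/-- The set of functions from `X` to `Y` that are continuous with respect to the
representations. -/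
def ContFun {X : Type u} {Y : Type v} (δX : Representation X) (δY : Representation Y) :
    Type (max u v) :=
  {f : X → Y // RepContinuous δX δY f}

/-- The function space representation `[δX → δY]`: `p` is a name of `f` if the partial function
with associate `p` is a realizer of `f`. -/
def arrowRep {X : Type u} {Y : Type v} (δX : Representation X) (δY : Representation Y) :
    Representation (ContFun δX δY) where
  toPFun := ofRel fun p f => Realizes δX δY (assoc p) fun x => {f.1 x}
  surj := by
    rintro ⟨f, F, hF, hFf⟩
    obtain ⟨p, hp⟩ := exists_assoc F hF
    refine ⟨p, (mem_ofRel ?_ _ _).2 ?_⟩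
    · intro p f g hf hg
      apply Subtype.ext
      funext x
      obtain ⟨q, hq⟩ := δX.surj x
      obtain ⟨r, hr, y, hy, hyf⟩ := hf q x hq ⟨_, rfl⟩
      obtain ⟨r', hr', y', hy', hyg⟩ := hg q x hq ⟨_, rfl⟩
      obtain rfl := Part.mem_unique hr hr'
      obtain rfl := Part.mem_unique hy hy'
      exact hyf.symm.trans hyg
    · intro q x hx hne
      obtain ⟨r, hr, hy⟩ := hFf q x hx hne
      exact ⟨r, hp q r hr, hy⟩

/-- The representation of Sierpinski space `{0, 1}`, here the type `Prop`:
`p` is a name of `1` (`True`) if and only if `p n = 0` for some `n`. -/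
def sierpinskiRep : Representation Prop where
  toPFun := fun p => Part.some (∃ n, p n = 0)
  surj := by
    intro s
    by_cases h : s
    · exact ⟨fun _ => 0, by simp [h]⟩
    · exact ⟨fun _ => 1, by simp [h]⟩

/-- The open subsets of a represented space: those with continuous characteristic function. -/
def OpenSets {X : Type u} (δ : Representation X) : Type u :=
  {U : Set X // RepContinuous δ sierpinskiRep fun x => x ∈ U}

/-- The closed subsets of a represented space. -/
def ClosedSets {X : Type u} (δ : Representation X) : Type u :=
  {A : Set X // RepContinuous δ sierpinskiRep fun x => x ∈ Aᶜ}

/-- The representation of the open subsets by names of their characteristic functions. -/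
def openRep {X : Type u} (δ : Representation X) : Representation (OpenSets δ) where
  toPFun := fun p => ((arrowRep δ sierpinskiRep).toPFun p).map fun f => ⟨{x | f.1 x}, f.2⟩
  surj := by
    intro U
    obtain ⟨p, hp⟩ := (arrowRep δ sierpinskiRep).surj ⟨fun x => x ∈ U.1, U.2⟩
    exact ⟨p, (Part.mem_map_iff _).2 ⟨_, hp, rfl⟩⟩

/-- The representation of the closed subsets by negative information: a name of `A` is a name of
its complement as an open set. -/
def negRep {X : Type u} (δ : Representation X) : Representation (ClosedSets δ) where
  toPFun := fun p => ((openRep δ).toPFun p).map fun U =>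
    ⟨U.1ᶜ, by rw [compl_compl]; exact U.2⟩
  surj := by
    intro A
    obtain ⟨p, hp⟩ := (openRep δ).surj ⟨A.1ᶜ, A.2⟩
    exact ⟨p, (Part.mem_map_iff _).2 ⟨_, hp, Subtype.ext (compl_compl A.1)⟩⟩

/-- Closed choice `C_X`: the multi-valued map `A ↦ A`, with domain the non-empty closed sets. -/
def closedChoice {X : Type u} (δ : Representation X) : ClosedSets δ → Set X := fun A => A.1

/-! ### Computable metric spaces and computable `K_σ`-spaces -/

/-- A computable metric space: a metric space with a dense sequence `α` such that
`(i, j) ↦ d (α i) (α j)` is a computable double sequence of real numbers. -/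
structure ComputableMetricSpace (X : Type u) [MetricSpace X] where
  α : ℕ → X
  dense : DenseRange α
  computable_dist : ∃ a : ℕ × ℕ × ℕ → ℕ, Computable a ∧
    ∀ i j k, |dist (α i) (α j) - (a (i, j, k) : ℝ) / 2 ^ k| ≤ 1 / 2 ^ k

namespace ComputableMetricSpace

variable {X : Type u} [MetricSpace X] (S : ComputableMetricSpace X)

/-- The Cauchy representation: `p` is a name of `x` if the sequence `α (p n)` is rapidly
converging with limit `x`. -/
def cauchyRep : Representation X where
  toPFun := ofRel fun p x => (∀ i j, j < i → dist (S.α (p i)) (S.α (p j)) < 1 / 2 ^ j) ∧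
    Tendsto (fun n => S.α (p n)) atTop (𝓝 x)
  surj := by
    intro x
    have h : ∀ n : ℕ, ∃ i, dist x (S.α i) < 1 / 2 ^ (n + 1) := fun n =>
      S.dense.exists_dist_lt x (by positivity)
    choose p hp using h
    refine ⟨p, (mem_ofRel (fun _ _ _ h h' => tendsto_nhds_unique h.2 h'.2) _ _).2 ⟨?_, ?_⟩⟩
    · intro i j hij
      have h1 := hp i
      have h2 := hp j
      have h3 : (1 : ℝ) / 2 ^ (i + 1) ≤ 1 / 2 ^ (j + 1) :=
        one_div_le_one_div_of_le (by positivity) (pow_le_pow_right₀ (by norm_num) (by omega))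
      have h4 : (1 : ℝ) / 2 ^ (j + 1) + 1 / 2 ^ (j + 1) = 1 / 2 ^ j := by
        rw [pow_succ]; field_simp; norm_num
      have h5 := dist_triangle_left (S.α (p i)) (S.α (p j)) x
      linarith
    · rw [tendsto_iff_dist_tendsto_zero]
      have h0 : Tendsto (fun n : ℕ => ((1 : ℝ) / 2) ^ (n + 1)) atTop (𝓝 0) :=
        (tendsto_pow_atTop_nhds_zero_of_lt_one (by norm_num) (by norm_num)).comp
          (tendsto_add_atTop_nat 1)
      refine squeeze_zero (fun _ => dist_nonneg) (fun n => ?_) h0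
      rw [dist_comm, div_pow, one_pow]
      exact (hp n).le

/-- The rational open ball with centre `α i` and radius `(a + 1) / (b + 1)`. -/
def ratBall (t : ℕ × ℕ × ℕ) : Set X :=
  Metric.ball (S.α t.1) (((t.2.1 : ℝ) + 1) / ((t.2.2 : ℝ) + 1))

/-- `p` is a `κ`-name of the compact set `K`: it lists all finite covers of `K` by rational open
balls each of which meets `K`. -/
def IsKappaName (p : Baire) (K : Set X) : Prop :=
  Set.range p = {c | ∃ l : List (ℕ × ℕ × ℕ), Encodable.encode l = c ∧
    (K ⊆ ⋃ t ∈ l, S.ratBall t) ∧ ∀ t ∈ l, (S.ratBall t ∩ K).Nonempty}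

/-- The space is a computable `K_σ`-space: it is the union of a computable sequence of non-empty
computably compact sets. -/
def IsComputableKSigma : Prop :=
  ∃ K : ℕ → TopologicalSpace.NonemptyCompacts X,
    (∃ p : ℕ → Baire, Computable₂ p ∧ ∀ i, S.IsKappaName (p i) (K i : Set X)) ∧
      (⋃ i, (K i : Set X)) = Set.univ

end ComputableMetricSpace

end TTE

end

/-! The first equivalence rests on pushing a computable map through `lowPFun`. The identity
represents both sides of `lowMap`, so its realizers are exactly the extensions of `lowPFun`, and a
realizer into the low representation gives a reduction with the identity as outer map. Conversely,
an outer map `H` pulls c.e. open sets back to c.e. open sets uniformly on its domain. Hence the jump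
of an image under `H` is a computable reindexing of the jump of the argument. Reindexing commutes
with limits, so `H` moves to the other side of `lowPFun` (`ComputablePFun.exists_low`).

Closed choice is solved by a uniform low basis theorem (`uniform_low_basis`). Computable nets turn
each compact piece into a compact box of sequences. Refuting sequences that do not converge rapidly,
and sequences excluded by the negative information, leaves compact sets of survivors. Every survivor
names a point of the given closed set, and some box has a survivor if that set is non-empty (not
every name need survive). By compactness, emptiness of a set of survivors is confirmed at a finite
stage, so it is decidable in the limit.

The jump of a suitable survivor is then forced index by index: avoid the next c.e. open set unless
nothing would be left. A compact intersection provides a point that obeys all these decisions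
(`exists_jump_eq_decidedJump`). Each decision, and the least index of a box with survivors, depends
on finitely many emptiness questions. Computable guesses therefore converge to the jump of that
point, which is precisely a low name. -/

namespace TTE

/-! ### Computable operations on lists, and unbounded search -/

section Tools

variable {α : Type*} {β : Type*} {γ : Type*} [Primcodable α] [Primcodable β] [Primcodable γ]

/-- The fold is a recursion on the list length that looks up one entry per stage. The step need only
be computable, and the list operations below are instances. -/
theorem computable_foldl {f : α → List β} {g : α → γ} {h : α → γ × β → γ}
    (hf : Computable f) (hg : Computable g) (hh : Computable₂ h) :
    Computable fun a => (f a).foldl (fun s b => h a (s, b)) (g a) := by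
  let step : α → ℕ × γ → γ := fun a x =>
    Option.casesOn ((f a)[x.1]?) x.2 fun b => h a (x.2, b)
  have hstep : Computable₂ step := by
    refine Computable.option_casesOn (o := fun z : α × ℕ × γ => (f z.1)[z.2.1]?)
      (f := fun z => z.2.2) (g := fun z b => h z.1 (z.2.2, b)) ?_ ?_ ?_
    · exact Computable.list_getElem?.comp (hf.comp Computable.fst)
        (Computable.fst.comp Computable.snd)
    · exact Computable.snd.comp Computable.snd
    · exact hh.comp (Computable.fst.comp Computable.fst)
        (Computable.pair (Computable.snd.comp (Computable.snd.comp Computable.fst)) Computable.snd)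
  refine (Computable.nat_rec (Computable.list_length.comp hf) hg hstep).of_eq fun a => ?_
  have key : ∀ n, (Nat.rec (g a) (fun y IH => step a (y, IH)) n : γ)
      = ((f a).take n).foldl (fun s b => h a (s, b)) (g a) := by
    intro n
    induction n with
    | zero => simp
    | succ n ih =>
      change step a (n, _) = _
      rw [ih, List.take_add_one, List.foldl_append]
      simp only [step]
      cases (f a)[n]? <;> simp
  rw [key, List.take_length]

theorem computable_all {f : α → List β} {q : α → β → Bool} (hf : Computable f)
    (hq : Computable₂ q) : Computable fun a => (f a).all (q a) := by
  have h : Computable₂ fun (a : α) (x : Bool × β) => x.1 && q a x.2 :=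
    Primrec.and.to_comp.comp (Computable.fst.comp Computable.snd)
      (hq.comp Computable.fst (Computable.snd.comp Computable.snd))
  refine (computable_foldl hf (Computable.const true) h).of_eq fun a => ?_
  have key : ∀ (l : List β) (c : Bool),
      l.foldl (fun s b => s && q a b) c = (c && l.all (q a)) := by
    intro l
    induction l with
    | nil => simp
    | cons b l ih => intro c; simp [ih, Bool.and_assoc]
  simpa using key (f a) true

theorem computable_any {f : α → List β} {q : α → β → Bool} (hf : Computable f)
    (hq : Computable₂ q) : Computable fun a => (f a).any (q a) := by
  refine (Primrec.not.to_comp.comp (computable_all (q := fun a b => !q a b) hf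
    (Primrec.not.to_comp.comp hq))).of_eq fun a => ?_
  simp [List.all_eq_not_any_not]

theorem computable_flatMap {f : α → List β} {q : α → β → List γ} (hf : Computable f)
    (hq : Computable₂ q) : Computable fun a => (f a).flatMap (q a) := by
  have h : Computable₂ fun (a : α) (x : List γ × β) => x.1 ++ q a x.2 :=
    Computable.list_append.comp (Computable.fst.comp Computable.snd)
      (hq.comp Computable.fst (Computable.snd.comp Computable.snd))
  refine (computable_foldl hf (Computable.const []) h).of_eq fun a => ?_
  have key : ∀ (l : List β) (c : List γ),
      l.foldl (fun s b => s ++ q a b) c = c ++ l.flatMap (q a) := by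
    intro l
    induction l with
    | nil => simp
    | cons b l ih => intro c; simp [ih]
  simpa using key (f a) []

theorem computable_map {f : α → List β} {q : α → β → γ} (hf : Computable f)
    (hq : Computable₂ q) : Computable fun a => (f a).map (q a) := by
  refine (computable_flatMap (q := fun a b => [q a b]) hf ?_).of_eq fun a => ?_
  · exact Computable.list_cons.comp hq (Computable.const [])
  · simp [List.map_eq_flatMap]

theorem computable_find {q : α → ℕ → Bool} (hq : Computable₂ q) (h : ∀ a, ∃ n, q a n = true) :
    Computable fun a => Nat.find (h a) := by
  have h1 : Partrec fun a => Nat.rfind fun n => Part.some (q a n) := Partrec.rfind hq.partrec₂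
  refine Partrec.of_eq h1 fun a => Part.eq_some_iff.2 ?_
  refine Nat.mem_rfind.2 ⟨?_, fun {m} hm => ?_⟩
  · simpa using (Nat.find_spec (h a)).symm
  · simpa using Nat.find_min (h a) hm

end Tools

/-! ### Step-bounded halting. -/

/-- The `n`-th partial recursive function is found to be defined at `x` within `t` steps. -/
def haltsWithin (t n x : ℕ) : Bool :=
  (Nat.Partrec.Code.evaln t (Nat.Partrec.Code.ofNatCode n) x).isSome

theorem computable_haltsWithin {α : Type*} [Primcodable α] {t n x : α → ℕ} (ht : Computable t)
    (hn : Computable n) (hx : Computable x) :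
    Computable fun a => haltsWithin (t a) (n a) (x a) := by
  have hc : Computable fun a => Denumerable.ofNat Nat.Partrec.Code (n a) :=
    (Computable.ofNat _).comp hn
  have h : Computable fun a =>
      Nat.Partrec.Code.evaln (t a) (Denumerable.ofNat Nat.Partrec.Code (n a)) (x a) :=
    Nat.Partrec.Code.primrec_evaln.to_comp.comp ((ht.pair hc).pair hx)
  exact Primrec.option_isSome.to_comp.comp h

theorem eval_dom_iff {n x : ℕ} :
    ((Nat.Partrec.Code.ofNatCode n).eval x).Dom ↔ ∃ t, haltsWithin t n x = true := by
  simp only [haltsWithin, Part.dom_iff_mem, Nat.Partrec.Code.evaln_complete,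
    Option.isSome_iff_exists, Option.mem_def]
  exact exists_comm

theorem haltsWithin_mono {s t n x : ℕ} (hst : s ≤ t) (h : haltsWithin s n x = true) :
    haltsWithin t n x = true := by
  obtain ⟨y, hy⟩ := Option.isSome_iff_exists.1 h
  exact Option.isSome_iff_exists.2 ⟨y, Nat.Partrec.Code.evaln_mono hst hy⟩

attribute [irreducible] haltsWithin

theorem mem_ceOpen_iff {p : Baire} {n : ℕ} :
    p ∈ ceOpen n ↔ ∃ k t, haltsWithin t n (Encodable.encode (pre p k)) = true := by
  simp only [ceOpen, Set.mem_ofPred_eq, eval_dom_iff]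

/-! ### Prefixes and computable partial functions on Baire space -/

@[simp] theorem length_pre (p : Baire) (k : ℕ) : (pre p k).length = k := by simp [pre]

theorem take_pre (p : Baire) (j k : ℕ) : (pre p k).take j = pre p (min j k) := by
  simp [pre, ← List.map_take, List.take_range]

theorem pre_prefix (p : Baire) {j k : ℕ} (h : j ≤ k) : pre p j <+: pre p k := by
  rw [← min_eq_left h, ← take_pre]
  exact List.take_prefix _ _

theorem getElem?_pre {p : Baire} {k i : ℕ} (h : i < k) : (pre p k)[i]? = some (p i) := by
  simp [pre, List.getElem?_range h]

theorem pre_eq_iff {p q : Baire} {k : ℕ} : pre p k = pre q k ↔ ∀ i < k, p i = q i :=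
  ⟨fun h => (pre_injOn h).2, fun h => by simpa [pre] using h⟩

theorem ComputablePFun.comp {F G : Baire →. Baire} (hF : ComputablePFun F)
    (hG : ComputablePFun G) : ComputablePFun (F.comp G) := by
  obtain ⟨φ, hφ, hφm, hφs⟩ := hF
  obtain ⟨ψ, hψ, hψm, hψs⟩ := hG
  refine ⟨fun w => φ (ψ w), hφ.comp hψ, fun u v h => hφm _ _ (hψm _ _ h), fun p r hr => ?_⟩
  obtain ⟨q, hq, hr⟩ := Part.mem_bind_iff.1 hr
  obtain ⟨h1, h2⟩ := hψs p q hq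
  obtain ⟨h3, h4⟩ := hφs q r hr
  refine ⟨fun k => ?_, fun n => ?_⟩
  · change φ (ψ (pre p k)) = pre r (φ (ψ (pre p k))).length
    rw [h1 k]
    exact h3 _
  · obtain ⟨k, hk⟩ := h4 n
    obtain ⟨l, hl⟩ := h2 k
    refine ⟨l, hk.trans ?_⟩
    change _ ≤ (φ (ψ (pre p l))).length
    rw [h1 l]
    exact (hφm _ _ (pre_prefix q hl)).length_le

theorem computablePFun_id : ComputablePFun (PFun.id Baire) := by
  refine ⟨id, Computable.id, fun _ _ h => h, fun p q hq => ?_⟩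
  obtain rfl : q = p := by simpa using hq
  exact ⟨fun k => by simp, fun n => ⟨n, by simp⟩⟩

/-- A function on Baire space is computable if its `c`-th value is computed from a prefix of the
input of computable length. -/
theorem computablePFun_of_prefix {g : List ℕ → ℕ → ℕ} (hg : Computable₂ g) {h : ℕ → ℕ}
    (hh : Computable h) :
    ComputablePFun ((fun p c => g (pre p (h c)) c : Baire → Baire) : Baire →. Baire) := by
  -- The least such `c` is the number of letters written on input `w`: all earlier values need at
  -- most `w.length` input letters. The bound `w.length ≤ c` makes the search terminate.
  have hex : ∀ w : List ℕ, ∃ c, decide (w.length ≤ c ∨ w.length < h c) = true :=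
    fun w => ⟨w.length, by simp⟩
  have hm : Computable fun w : List ℕ => Nat.find (hex w) := by
    refine computable_find ?_ hex
    have hl : Computable fun x : List ℕ × ℕ => x.1.length :=
      Computable.list_length.comp Computable.fst
    have h1 : Computable fun x : List ℕ × ℕ => decide (x.1.length ≤ x.2) :=
      Primrec.nat_le.decide.to_comp.comp hl Computable.snd
    have h2 : Computable fun x : List ℕ × ℕ => decide (x.1.length < h x.2) :=
      Primrec.nat_lt.decide.to_comp.comp hl (hh.comp Computable.snd)
    exact (Primrec.or.to_comp.comp h1 h2).of_eq fun x => by simp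
  have hlt : ∀ w c, c < Nat.find (hex w) → h c ≤ w.length := by
    intro w c hc
    have := Nat.find_min (hex w) hc
    simp only [decide_eq_true_eq, not_or, not_lt] at this
    exact this.2
  have hle : ∀ w n, (∀ c < n, c < w.length ∧ h c ≤ w.length) → n ≤ Nat.find (hex w) := by
    intro w n hn
    refine (Nat.le_find_iff _ _).2 fun c hc => ?_
    have := hn c hc
    simp only [decide_eq_true_eq, not_or]
    omega
  have hspec : ∀ p k, (List.range (Nat.find (hex (pre p k)))).map
      (fun c => g ((pre p k).take (h c)) c) =
      pre (fun c => g (pre p (h c)) c) (Nat.find (hex (pre p k))) := by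
    intro p k
    refine List.map_congr_left fun c hc => ?_
    have := hlt _ _ (List.mem_range.1 hc)
    rw [length_pre] at this
    rw [take_pre, min_eq_left this]
  refine ⟨fun w => (List.range (Nat.find (hex w))).map fun c => g (w.take (h c)) c, ?_, ?_, ?_⟩
  · refine computable_map (Primrec.list_range.to_comp.comp hm) ?_
    exact hg.comp (Primrec.list_take.to_comp.comp (hh.comp Computable.snd) Computable.fst)
      Computable.snd
  · intro v w hvw
    have h1 : Nat.find (hex v) ≤ Nat.find (hex w) := by
      refine hle w _ fun c hc => ?_
      have h2 := hlt v c hc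
      have h3 := Nat.find_min (hex v) hc
      simp only [decide_eq_true_eq, not_or] at h3
      have := hvw.length_le
      omega
    have h2 : (List.range (Nat.find (hex v))).map (fun c => g (v.take (h c)) c) =
        (List.range (Nat.find (hex v))).map (fun c => g (w.take (h c)) c) := by
      refine List.map_congr_left fun c hc => ?_
      have h3 := hlt v c (List.mem_range.1 hc)
      obtain ⟨s, rfl⟩ := hvw
      rw [List.take_append_of_le_length h3]
    simp only [h2]
    refine List.IsPrefix.map _ ?_
    rw [← min_eq_left h1, ← List.take_range]
    exact List.take_prefix _ _
  · intro p q hq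
    obtain rfl : q = fun c => g (pre p (h c)) c := by simpa using hq
    refine ⟨fun k => ?_, fun n => ?_⟩
    · simp only [List.length_map, List.length_range]
      exact hspec p k
    · refine ⟨n + (Finset.range n).sup h, ?_⟩
      simp only [List.length_map, List.length_range]
      refine hle _ n fun c hc => ?_
      have : h c ≤ (Finset.range n).sup h := Finset.le_sup (Finset.mem_range.2 hc)
      rw [length_pre]
      omega

/-! ### The jump of a computable image -/

/-- Preimages of c.e. open sets under computable functions are uniformly c.e. open. -/
theorem ComputablePFun.exists_preimage_ceOpen {H : Baire →. Baire} (hH : ComputablePFun H) :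
    ∃ s : ℕ → ℕ, Computable s ∧ ∀ p, ∀ q ∈ H p, ∀ n, q ∈ ceOpen n ↔ p ∈ ceOpen (s n) := by
  obtain ⟨φ, hφ, -, hφs⟩ := hH
  -- Here `x` codes an index and an input word, `m` a step count and a length. Shorter prefixes of
  -- the output must be tested too, since the output may jump over the word on which the machine
  -- halts.
  let test : ℕ → ℕ → Bool := fun x m =>
    haltsWithin m.unpair.1 x.unpair.1 (Encodable.encode
      ((φ ((Encodable.decode (α := List ℕ) x.unpair.2).getD [])).take m.unpair.2))
  have htest : Computable₂ test := by
    have hu1 : Computable fun z : ℕ × ℕ => z.1.unpair :=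
      Primrec.unpair.to_comp.comp Computable.fst
    have hu2 : Computable fun z : ℕ × ℕ => z.2.unpair :=
      Primrec.unpair.to_comp.comp Computable.snd
    have hd : Computable fun z : ℕ × ℕ => Encodable.decode (α := List ℕ) z.1.unpair.2 :=
      Computable.decode.comp (Computable.snd.comp hu1)
    have hw : Computable fun z : ℕ × ℕ =>
        φ ((Encodable.decode (α := List ℕ) z.1.unpair.2).getD []) :=
      hφ.comp (Computable.option_getD hd (Computable.const []))
    have hx : Computable fun z : ℕ × ℕ => Encodable.encode
        ((φ ((Encodable.decode (α := List ℕ) z.1.unpair.2).getD [])).take z.2.unpair.2) :=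
      Computable.encode.comp (Primrec.list_take.to_comp.comp (Computable.snd.comp hu2) hw)
    exact computable_haltsWithin (Computable.fst.comp hu2) (Computable.fst.comp hu1) hx
  have hp : Partrec fun x => Nat.rfind fun m => Part.some (test x m) :=
    Partrec.rfind htest.partrec₂
  obtain ⟨c, hc⟩ := Nat.Partrec.Code.exists_code.1 (Partrec.nat_iff.1 hp)
  -- The s-m-n theorem: fixing the index in the code `c` is computable.
  refine ⟨fun n => Encodable.encode (c.curry n), ?_, fun p q hq n => ?_⟩
  · exact Computable.encode.comp
      (Nat.Partrec.Code.primrec₂_curry.to_comp.comp (Computable.const c) Computable.id)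
  obtain ⟨h1, h2⟩ := hφs p q hq
  have hcode : Nat.Partrec.Code.ofNatCode (Encodable.encode (c.curry n)) = c.curry n :=
    Denumerable.ofNat_encode (c.curry n)
  have hdom : ∀ k, ((c.curry n).eval (Encodable.encode (pre p k))).Dom ↔
      ∃ m, test (Nat.pair n (Encodable.encode (pre p k))) m = true := by
    intro k
    rw [Nat.Partrec.Code.eval_curry, hc]
    refine (Nat.rfind_dom (p := (fun m => Part.some
      (test (Nat.pair n (Encodable.encode (pre p k))) m) : ℕ →. Bool))).trans ?_
    simp
  rw [mem_ceOpen_iff]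
  simp only [ceOpen, Set.mem_ofPred_eq, hcode, hdom, test,
    Nat.unpair_pair, Encodable.encodek, Option.getD_some]
  constructor
  · rintro ⟨l, t, ht⟩
    obtain ⟨k, hk⟩ := h2 l
    refine ⟨k, Nat.pair t l, ?_⟩
    rw [h1 k, take_pre, Nat.unpair_pair, min_eq_left hk]
    exact ht
  · rintro ⟨k, m, hm⟩
    rw [h1 k, take_pre] at hm
    exact ⟨_, _, hm⟩

/-- The jump of `r` at `n` is the jump of `q` at `s n`. Thus `M` only has to copy, in every row of
`p`, the entry `s n` to place `n`. -/
theorem ComputablePFun.exists_low {H : Baire →. Baire} (hH : ComputablePFun H) :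
    ∃ M : Baire →. Baire, ComputablePFun M ∧
      ∀ p, ∀ q ∈ lowPFun p, ∀ r ∈ H q, ∃ m ∈ M p, r ∈ lowPFun m := by
  obtain ⟨s, hs, hsH⟩ := hH.exists_preimage_ceOpen
  let e : ℕ → ℕ := fun c => Nat.pair c.unpair.1 (s c.unpair.2)
  have he : Computable e :=
    Primrec₂.natPair.to_comp.comp (Computable.fst.comp Computable.unpair)
      (hs.comp (Computable.snd.comp Computable.unpair))
  -- The prefix supplied has length `e c + 1`, so the default `0` is never used.
  have hg : Computable₂ fun (w : List ℕ) (c : ℕ) => (w[e c]?).getD 0 :=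
    Computable.option_getD (Computable.list_getElem?.comp Computable.fst (he.comp Computable.snd))
      (Computable.const 0)
  refine ⟨_, computablePFun_of_prefix hg (Computable.succ.comp he), fun p q hq r hr => ?_⟩
  refine ⟨_, Part.mem_some _, ?_⟩
  obtain ⟨a, ha, hqa⟩ := Part.mem_bind_iff.1 hq
  refine Part.mem_bind_iff.2 ⟨fun n => a (s n), ?_, ?_⟩
  · rw [mem_limMap, tendsto_pi_nhds] at ha ⊢
    intro n
    refine (ha (s n)).congr fun i => ?_
    change _ = ((pre p (e (Nat.pair i n)).succ)[e (Nat.pair i n)]?).getD 0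
    rw [getElem?_pre (Nat.lt_succ_self _)]
    simp [e]
  · rw [mem_jumpInv] at hqa ⊢
    subst hqa
    funext n
    simp only [jump]
    by_cases h : r ∈ ceOpen n
    · rw [if_pos h, if_pos ((hsH q r hr n).1 h)]
    · rw [if_neg h, if_neg (h ∘ (hsH q r hr n).2)]

theorem mem_low_toPFun {X : Type u} {δ : Representation X} {p : Baire} {x : X} :
    x ∈ δ.low.toPFun p ↔ ∃ q ∈ lowPFun p, x ∈ δ.toPFun q := by
  simp only [Representation.low, Representation.derivative, Representation.integral, lowPFun]
  constructor
  · intro h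
    obtain ⟨a, ha, h⟩ := Part.mem_bind_iff.1 h
    obtain ⟨q, hq, h⟩ := Part.mem_bind_iff.1 h
    exact ⟨q, Part.mem_bind_iff.2 ⟨a, ha, hq⟩, h⟩
  · rintro ⟨q, hq, h⟩
    obtain ⟨a, ha, hq⟩ := Part.mem_bind_iff.1 hq
    exact Part.mem_bind_iff.2 ⟨a, ha, Part.mem_bind_iff.2 ⟨q, hq, h⟩⟩

/-- With identity representations and a single-valued map there is no freedom in the values on the
domain; in particular `lowPFun` realizes `lowMap`. -/
theorem realizes_lowMap_iff {G : Baire →. Baire} :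
    Realizes baireRep baireRep G lowMap ↔ ∀ p, ∀ q ∈ lowPFun p, q ∈ G p := by
  constructor
  · intro h p q hq
    obtain ⟨r, hr, y, hy, hyq⟩ := h p p (Part.mem_some p) ⟨q, hq⟩
    obtain rfl : y = r := by simpa [baireRep] using hy
    rwa [Part.mem_unique hq hyq]
  · rintro h p x hx ⟨q, hq⟩
    obtain rfl : x = p := by simpa [baireRep] using hx
    exact ⟨q, h _ q hq, q, Part.mem_some q, hq⟩

/-- A multi-valued function is low computable if and only if it is reducible to `L`. -/
theorem lowComputable_iff {X : Type u} {Y : Type v} (δX : Representation X)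
    (δY : Representation Y) (f : X → Set Y) :
    LowComputable δX δY f ↔ StrongWeihrauchLE δX δY f baireRep baireRep lowMap := by
  constructor
  · rintro ⟨F, hF, hFf⟩
    refine ⟨PFun.id Baire, F, computablePFun_id, hF, fun G hG p x hx hne => ?_⟩
    obtain ⟨q, hq, y, hy, hyf⟩ := hFf p x hx hne
    obtain ⟨r, hr, hy⟩ := mem_low_toPFun.1 hy
    exact ⟨r, Part.mem_bind_iff.2 ⟨r, Part.mem_bind_iff.2
      ⟨q, hq, realizes_lowMap_iff.1 hG q r hr⟩, Part.mem_some r⟩, y, hy, hyf⟩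
  · rintro ⟨H, K, hH, hK, h⟩
    obtain ⟨M, hM, hMH⟩ := hH.exists_low
    refine ⟨M.comp K, hM.comp hK, fun p x hx hne => ?_⟩
    -- The reduction is needed only for the realizer `lowPFun` itself; `M` then absorbs `H`.
    obtain ⟨r, hr, y, hy, hyf⟩ := h lowPFun (realizes_lowMap_iff.2 fun _ _ h => h) p x hx hne
    obtain ⟨b, hb, hr⟩ := Part.mem_bind_iff.1 hr
    obtain ⟨a, ha, hb⟩ := Part.mem_bind_iff.1 hb
    obtain ⟨m, hm, hrm⟩ := hMH a b hb r hr
    exact ⟨m, Part.mem_bind_iff.2 ⟨a, ha, hm⟩, y, mem_low_toPFun.2 ⟨r, hrm, hy⟩, hyf⟩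

/-! ### Compact product sets in Baire space -/

theorem pre_succ (p : Baire) (k : ℕ) : pre p (k + 1) = pre p k ++ [p k] := by
  simp [pre, List.range_succ]

theorem isOpen_setOf_pre (P : List ℕ → Prop) (k : ℕ) : IsOpen {p : Baire | P (pre p k)} := by
  refine isOpen_iff_mem_nhds.2 fun p hp => ?_
  have ho : IsOpen (⋂ i ∈ Finset.range k, {q : Baire | q i = p i}) :=
    isOpen_biInter_finset fun i _ =>
      (isOpen_discrete {p i}).preimage (continuous_apply i : Continuous fun q : Baire => q i)
  refine mem_of_superset (ho.mem_nhds (by simp)) fun q hq => ?_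
  have h : pre q k = pre p k := pre_eq_iff.2 fun i hi => by
    simpa using Set.mem_iInter₂.1 hq i (Finset.mem_range.2 hi)
  simpa [h] using hp

theorem isOpen_ceOpen (n : ℕ) : IsOpen (ceOpen n) := by
  have : ceOpen n = ⋃ k, {p | ((Nat.Partrec.Code.ofNatCode n).eval
      (Encodable.encode (pre p k))).Dom} := by
    ext p
    simp [ceOpen]
  rw [this]
  exact isOpen_iUnion fun k => isOpen_setOf_pre (fun w => ((Nat.Partrec.Code.ofNatCode n).eval
      (Encodable.encode w)).Dom) k

/-- The set of sequences whose `n`-th entry belongs to `F n`. -/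
def box (F : ℕ → List ℕ) : Set Baire := {r | ∀ n, r n ∈ F n}

theorem isCompact_box (F : ℕ → List ℕ) : IsCompact (box F) := by
  have : box F = Set.pi Set.univ fun n => {x | x ∈ F n} := by
    ext r
    simp [box]
  rw [this]
  exact isCompact_univ_pi fun n => (List.finite_toSet (F n)).isCompact

/-- The words of length `t` whose `n`-th letter belongs to `F n`. -/
def words (F : ℕ → List ℕ) : ℕ → List (List ℕ)
  | 0 => [[]]
  | t + 1 => (words F t).flatMap fun w => (F t).map fun x => w ++ [x]

theorem pre_mem_words {F : ℕ → List ℕ} {r : Baire} (hr : r ∈ box F) (t : ℕ) :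
    pre r t ∈ words F t := by
  induction t with
  | zero => simp [words, pre]
  | succ t ih =>
    rw [pre_succ]
    exact List.mem_flatMap.2 ⟨_, ih, List.mem_map.2 ⟨_, hr t, rfl⟩⟩

/-- As no factor is empty, every finite word of the box extends to an infinite sequence in it.
Checking words is thus the same as checking prefixes of points. -/
theorem exists_pre_of_mem_words {F : ℕ → List ℕ} (hF : ∀ n, F n ≠ []) {t : ℕ} {w : List ℕ}
    (hw : w ∈ words F t) : ∃ r ∈ box F, pre r t = w := by
  induction t generalizing w with
  | zero =>
    refine ⟨fun n => (F n).head (hF n), fun n => List.head_mem _, ?_⟩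
    simpa [words, pre, eq_comm] using hw
  | succ t ih =>
    obtain ⟨w', hw', h⟩ := List.mem_flatMap.1 hw
    obtain ⟨x, hx, rfl⟩ := List.mem_map.1 h
    obtain ⟨r, hr, rfl⟩ := ih hw'
    refine ⟨Function.update r t x, fun n => ?_, ?_⟩
    · by_cases hn : n = t
      · subst hn; simpa using hx
      · simpa [hn] using hr n
    · rw [pre_succ, Function.update_self]
      congr 1
      exact pre_eq_iff.2 fun i hi => by simp [hi.ne]

theorem computable_words {α : Type*} [Primcodable α] {F : α → ℕ → List ℕ} (hF : Computable₂ F) :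
    Computable₂ fun a t => words (F a) t := by
  have h1 : Computable₂ fun (z : (α × ℕ) × ℕ × List (List ℕ)) (w : List ℕ) =>
      (F z.1.1 z.2.1).map fun x => w ++ [x] := by
    refine computable_map (f := fun y : ((α × ℕ) × ℕ × List (List ℕ)) × List ℕ =>
      F y.1.1.1 y.1.2.1) (q := fun y x => y.2 ++ [x]) ?_ ?_
    · exact hF.comp (Computable.fst.comp (Computable.fst.comp Computable.fst))
        (Computable.fst.comp (Computable.snd.comp Computable.fst))
    · exact Computable.list_concat.comp (Computable.snd.comp Computable.fst) Computable.snd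
  have h2 : Computable₂ fun (a : α × ℕ) (y : ℕ × List (List ℕ)) =>
      y.2.flatMap fun w => (F a.1 y.1).map fun x => w ++ [x] :=
    computable_flatMap (Computable.snd.comp Computable.snd) h1
  refine (Computable.nat_rec (f := fun a : α × ℕ => a.2) (g := fun _ => [[]]) Computable.snd
    (Computable.const _) h2).of_eq fun a => ?_
  induction a.2 with
  | zero => rfl
  | succ t ih => simp only [words, ← ih]

/-! ### Emptiness of effectively closed sets -/

/-- The effectively closed set of all `r` in the box `F` that are never refuted by `K`. -/
def survivors (F : ℕ → List ℕ) (K : List ℕ → List ℕ → Bool) (p : Baire) : Set Baire :=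
  {r | r ∈ box F ∧ ∀ t, K (pre p t) (pre r t) = false}

/-- `K` respects the prefix order in both arguments. -/
def PrefixMono (K : List ℕ → List ℕ → Bool) : Prop :=
  ∀ v v' w w', v <+: v' → w <+: w' → K v w = true → K v' w' = true

theorem isCompact_survivors (F : ℕ → List ℕ) (K : List ℕ → List ℕ → Bool) (p : Baire) :
    IsCompact (survivors F K p) := by
  refine (isCompact_box F).inter_right (t := {r | ∀ t, K (pre p t) (pre r t) = false}) ?_
  simp only [Set.ofPred_forall]
  refine isClosed_iInter fun t => isOpen_compl_iff.1 ?_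
  exact isOpen_setOf_pre (fun w => ¬ K (pre p t) w = false) t

/-- All words of length `v.length` in the box `F` are refuted. -/
def allRefuted (F : ℕ → List ℕ) (K : List ℕ → List ℕ → Bool) (v : List ℕ) : Bool :=
  (words F v.length).all (K v)

theorem allRefuted_mono {F : ℕ → List ℕ} (hF : ∀ n, F n ≠ []) {K : List ℕ → List ℕ → Bool}
    (hK : PrefixMono K) (p : Baire) {s t : ℕ} (hst : s ≤ t)
    (h : allRefuted F K (pre p s) = true) : allRefuted F K (pre p t) = true := by
  simp only [allRefuted, length_pre, List.all_eq_true] at h ⊢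
  intro w hw
  obtain ⟨r, hr, rfl⟩ := exists_pre_of_mem_words hF hw
  exact hK _ _ _ _ (pre_prefix p hst) (pre_prefix r hst) (h _ (pre_mem_words hr s))

/-- If nothing survives, the open sets of points refuted by stage `t` form an increasing cover of
the compact box, so a single stage refutes everything. Emptiness is thereby semidecidable. -/
theorem exists_allRefuted_iff {F : ℕ → List ℕ} (hF : ∀ n, F n ≠ []) {K : List ℕ → List ℕ → Bool}
    (hK : PrefixMono K) (p : Baire) :
    (∃ t, allRefuted F K (pre p t) = true) ↔ survivors F K p = ∅ := by
  constructor
  · rintro ⟨t, ht⟩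
    refine Set.eq_empty_of_forall_notMem fun r hr => ?_
    simp only [allRefuted, length_pre, List.all_eq_true] at ht
    simpa [hr.2 t] using ht _ (pre_mem_words hr.1 t)
  · intro h
    obtain ⟨t, ht⟩ := (isCompact_box F).elim_directed_cover
      (fun t => {r : Baire | K (pre p t) (pre r t) = true})
      (fun t => isOpen_setOf_pre (fun w => K (pre p t) w = true) t)
      (fun r hr => by
        by_contra hc
        refine Set.notMem_empty r (h ▸ ⟨hr, fun t => ?_⟩)
        by_contra ht
        exact hc (Set.mem_iUnion.2 ⟨t, by simpa using ht⟩))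
      (directed_of_isDirected_le fun s t hst r hr =>
        hK _ _ _ _ (pre_prefix p hst) (pre_prefix r hst) hr)
    refine ⟨t, ?_⟩
    simp only [allRefuted, length_pre, List.all_eq_true]
    intro w hw
    obtain ⟨r, hr, rfl⟩ := exists_pre_of_mem_words hF hw
    exact ht hr

theorem eventually_allRefuted_iff {F : ℕ → List ℕ} (hF : ∀ n, F n ≠ [])
    {K : List ℕ → List ℕ → Bool} (hK : PrefixMono K) (p : Baire) :
    ∀ᶠ t in atTop, (allRefuted F K (pre p t) = true ↔ survivors F K p = ∅) := by
  by_cases h : survivors F K p = ∅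
  · obtain ⟨s, hs⟩ := (exists_allRefuted_iff hF hK p).2 h
    filter_upwards [eventually_ge_atTop s] with t ht
    exact iff_of_true (allRefuted_mono hF hK p ht hs) h
  · exact Eventually.of_forall fun t =>
      iff_of_false (fun ht => h ((exists_allRefuted_iff hF hK p).1 ⟨t, ht⟩)) h

/-- Strengthen the refutation `K` by refuting the elements of `ceOpen m` for all `m ∈ σ`. -/
def refuteOpen (K : List ℕ → List ℕ → Bool) (σ : List ℕ) (v w : List ℕ) : Bool :=
  K v w || σ.any fun m => (List.range (w.length + 1)).any fun k =>
    haltsWithin v.length m (Encodable.encode (w.take k))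

theorem refuteOpen_eq_true {K : List ℕ → List ℕ → Bool} {σ v w : List ℕ} :
    refuteOpen K σ v w = true ↔ K v w = true ∨ ∃ m ∈ σ, ∃ k ≤ w.length,
      haltsWithin v.length m (Encodable.encode (w.take k)) = true := by
  simp only [refuteOpen, Bool.or_eq_true, List.any_eq_true, List.mem_range, Nat.lt_succ_iff]

theorem PrefixMono.refuteOpen {K : List ℕ → List ℕ → Bool} (hK : PrefixMono K) (σ : List ℕ) :
    PrefixMono (refuteOpen K σ) := by
  intro v v' w w' hv hw h
  rw [refuteOpen_eq_true] at h ⊢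
  rcases h with h | ⟨m, hm, k, hk, h⟩
  · exact Or.inl (hK _ _ _ _ hv hw h)
  · refine Or.inr ⟨m, hm, k, hk.trans hw.length_le, ?_⟩
    obtain ⟨s, rfl⟩ := hw
    rw [List.take_append_of_le_length hk]
    exact haltsWithin_mono hv.length_le h

/-- Avoiding finitely many c.e. open sets is again survival of a refutation procedure, so each
forcing question becomes an emptiness question of the same kind. -/
theorem survivors_refuteOpen (F : ℕ → List ℕ) (K : List ℕ → List ℕ → Bool) (σ : List ℕ)
    (p : Baire) :
    survivors F (refuteOpen K σ) p = survivors F K p ∩ {r | ∀ m ∈ σ, r ∉ ceOpen m} := by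
  ext r
  simp only [survivors, Set.mem_ofPred_eq, Set.mem_inter_iff, ← Bool.not_eq_true,
    refuteOpen_eq_true, mem_ceOpen_iff, length_pre]
  constructor
  · rintro ⟨hr, h⟩
    refine ⟨⟨hr, fun t ht => h t (Or.inl ht)⟩, ?_⟩
    rintro m hm ⟨k, t, hkt⟩
    refine h (max k t) (Or.inr ⟨m, hm, k, le_max_left k t, ?_⟩)
    rw [take_pre, min_eq_left (le_max_left k t)]
    exact haltsWithin_mono (le_max_right k t) hkt
  · rintro ⟨⟨hr, h⟩, h'⟩
    refine ⟨hr, fun t ht => ?_⟩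
    rcases ht with ht | ⟨m, hm, k, hk, ht⟩
    · exact h t ht
    · rw [take_pre] at ht
      exact h' m hm ⟨_, _, ht⟩

/-! ### The low basis theorem -/

/-- The indices below `n` that are avoided when, at each index in turn, the corresponding c.e. open
set is avoided unless the test `E` declares this impossible. -/
def avoided (E : List ℕ → Bool) : ℕ → List ℕ
  | 0 => []
  | n + 1 => bif E (n :: avoided E n) then avoided E n else n :: avoided E n

/-- The jump that is decided by avoiding c.e. open sets whenever possible. -/
def decidedJump (E : List ℕ → Bool) (n : ℕ) : ℕ := bif E (n :: avoided E n) then 1 else 0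

/-- The sets left after each decision are compact, decreasing and non-empty, hence have a common
point. That point avoids every set it was told to avoid, and cannot avoid the others. -/
theorem exists_jump_eq_decidedJump {Q : Set Baire} (hQ : IsCompact Q) (hne : Q.Nonempty)
    {E : List ℕ → Bool}
    (hE : ∀ σ, E σ = true ↔ Q ∩ {r | ∀ m ∈ σ, r ∉ ceOpen m} = ∅) :
    ∃ r ∈ Q, jump r = decidedJump E := by
  let T : ℕ → Set Baire := fun n => Q ∩ {r | ∀ m ∈ avoided E n, r ∉ ceOpen m}
  have hsub : ∀ n, avoided E n ⊆ avoided E (n + 1) := by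
    intro n
    cases h : E (n :: avoided E n) <;> simp [avoided, h]
  have hT0 : T 0 = Q := by simp [T, avoided]
  have hTne : ∀ n, (T n).Nonempty := by
    intro n
    induction n with
    | zero => rwa [hT0]
    | succ n ih =>
      cases h : E (n :: avoided E n)
      · have h1 : ¬ E (n :: avoided E n) = true := by simp [h]
        rw [hE, ← ne_eq, ← Set.nonempty_iff_ne_empty] at h1
        simpa only [T, avoided, h, cond_false] using h1
      · simpa only [T, avoided, h, cond_true] using ih
  have hclosed : ∀ n, IsClosed (T n) := by
    intro n
    refine hQ.isClosed.inter ?_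
    have : {r | ∀ m ∈ avoided E n, r ∉ ceOpen m} = ⋂ m ∈ avoided E n, (ceOpen m)ᶜ := by
      ext r
      simp
    rw [this]
    exact isClosed_biInter fun m _ => (isOpen_ceOpen m).isClosed_compl
  obtain ⟨r, hr⟩ := IsCompact.nonempty_iInter_of_sequence_nonempty_isCompact_isClosed T
    (fun n r hr => ⟨hr.1, fun m hm => hr.2 m (hsub n hm)⟩) hTne (hT0 ▸ hQ) hclosed
  rw [Set.mem_iInter] at hr
  refine ⟨r, (hr 0).1, funext fun n => ?_⟩
  cases h : E (n :: avoided E n)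
  · have h1 : r ∉ ceOpen n := (hr (n + 1)).2 n (by simp [avoided, h])
    simp [jump, decidedJump, h, h1]
  -- Otherwise `r` would lie in a set that `E` has declared empty.
  · have h1 : r ∈ ceOpen n := by
      by_contra hn
      refine Set.notMem_empty r ((hE _).1 h ▸ ⟨(hr 0).1, fun m hm => ?_⟩)
      rcases List.mem_cons.1 hm with rfl | hm
      · exact hn
      · exact (hr n).2 m hm
    simp [jump, decidedJump, h, h1]

/-- Only finitely many questions are asked below `n`; once earlier answers agree with `E'`, the next
question does too, so pointwise convergence of the tests suffices. -/
theorem eventually_avoided_eq {E : ℕ → List ℕ → Bool} {E' : List ℕ → Bool}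
    (h : ∀ σ, ∀ᶠ t in atTop, E t σ = E' σ) (n : ℕ) :
    ∀ᶠ t in atTop, avoided (E t) n = avoided E' n := by
  induction n with
  | zero => exact Eventually.of_forall fun _ => rfl
  | succ n ih =>
    filter_upwards [ih, h (n :: avoided E' n)] with t h1 h2
    simp only [avoided, h1, h2]

theorem eventually_decidedJump_eq {E : ℕ → List ℕ → Bool} {E' : List ℕ → Bool}
    (h : ∀ σ, ∀ᶠ t in atTop, E t σ = E' σ) (n : ℕ) :
    ∀ᶠ t in atTop, decidedJump (E t) n = decidedJump E' n := by
  filter_upwards [eventually_avoided_eq h n, h (n :: avoided E' n)] with t h1 h2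
  simp only [decidedJump, h1, h2]

/-! ### Computability of the approximations. -/

section Computability

variable {α : Type*} [Primcodable α]

theorem computable_avoided {E : α → List ℕ → Bool} (hE : Computable₂ E) :
    Computable₂ fun a n => avoided (E a) n := by
  have hc : Computable fun z : (α × ℕ) × ℕ × List ℕ => z.2.1 :: z.2.2 :=
    Computable.list_cons.comp (Computable.fst.comp Computable.snd)
      (Computable.snd.comp Computable.snd)
  have h : Computable₂ fun (z : α × ℕ) (y : ℕ × List ℕ) =>
      bif E z.1 (y.1 :: y.2) then y.2 else y.1 :: y.2 :=
    Computable.cond (hE.comp (Computable.fst.comp Computable.fst) hc)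
      (Computable.snd.comp Computable.snd) hc
  refine (Computable.nat_rec (f := fun z : α × ℕ => z.2) (g := fun _ => []) Computable.snd
    (Computable.const _) h).of_eq fun z => ?_
  induction z.2 with
  | zero => rfl
  | succ n ih => simp only [avoided, ← ih]

theorem computable_decidedJump {E : α → List ℕ → Bool} (hE : Computable₂ E) :
    Computable₂ fun a n => decidedJump (E a) n :=
  Computable.cond (hE.comp Computable.fst (Computable.list_cons.comp Computable.snd
    (computable_avoided hE))) (Computable.const 1) (Computable.const 0)

theorem computable_refuteOpen {K : List ℕ → List ℕ → Bool} (hK : Computable₂ K)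
    {σ v w : α → List ℕ} (hs : Computable σ) (hv : Computable v) (hw : Computable w) :
    Computable fun a => refuteOpen K (σ a) (v a) (w a) := by
  refine Primrec.or.to_comp.comp (hK.comp hv hw) (computable_any hs ?_)
  refine computable_any (f := fun z : α × ℕ => List.range ((w z.1).length + 1))
    (q := fun z k => haltsWithin (v z.1).length z.2 (Encodable.encode ((w z.1).take k))) ?_ ?_
  · exact Primrec.list_range.to_comp.comp (Computable.succ.comp
      (Computable.list_length.comp (hw.comp Computable.fst)))
  · have h1 : Computable fun z : (α × ℕ) × ℕ => z.1.1 := Computable.fst.comp Computable.fst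
    exact computable_haltsWithin (Computable.list_length.comp (hv.comp h1))
      (Computable.snd.comp Computable.fst) (Computable.encode.comp
        (Primrec.list_take.to_comp.comp Computable.snd (hw.comp h1)))

theorem computable_allRefuted {F : ℕ → ℕ → List ℕ} (hF : Computable₂ F)
    {K : List ℕ → List ℕ → Bool} (hK : Computable₂ K) {i : α → ℕ} {σ v : α → List ℕ}
    (hi : Computable i) (hs : Computable σ) (hv : Computable v) :
    Computable fun a => allRefuted (F (i a)) (refuteOpen K (σ a)) (v a) := by
  refine computable_all (q := fun a w => refuteOpen K (σ a) (v a) w) ?_ ?_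
  · exact (computable_words hF).comp hi (Computable.list_length.comp hv)
  · exact computable_refuteOpen hK (hs.comp Computable.fst) (hv.comp Computable.fst)
      Computable.snd

end Computability

/-- The uniform low basis theorem: given a sequence of computably bounded boxes and a computable
refutation procedure, a low name of a survivor in one of the boxes can be computed. -/
theorem uniform_low_basis {F : ℕ → ℕ → List ℕ} (hF : Computable₂ F) (hF0 : ∀ i n, F i n ≠ [])
    {K : List ℕ → List ℕ → Bool} (hK : Computable₂ K) (hKm : PrefixMono K) :
    ∃ M : Baire →. Baire, ComputablePFun M ∧
      ∀ p, (∃ i, (survivors (F i) K p).Nonempty) →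
        ∃ q ∈ M p, ∃ r ∈ lowPFun q, ∃ i, r ∈ survivors (F i) K p := by
  classical
  -- The guess at stage `v.length` is the first box not yet seen to be empty, with a cap that ends
  -- the search. The empty list in `refuteOpen K []` adds no refutations.
  have hidx : ∀ v : List ℕ, ∃ i,
      (decide (v.length ≤ i) || !allRefuted (F i) (refuteOpen K []) v) = true :=
    fun v => ⟨v.length, by simp⟩
  let idx : List ℕ → ℕ := fun v => Nat.find (hidx v)
  have hidxc : Computable idx := by
    have h1 : Computable fun z : List ℕ × ℕ => decide (z.1.length ≤ z.2) :=
      Primrec.nat_le.decide.to_comp.comp (Computable.list_length.comp Computable.fst)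
        Computable.snd
    have h2 : Computable fun z : List ℕ × ℕ => allRefuted (F z.2) (refuteOpen K []) z.1 :=
      computable_allRefuted hF hK Computable.snd (Computable.const []) Computable.fst
    have h3 : Computable fun z : List ℕ × ℕ =>
        decide (z.1.length ≤ z.2) || !allRefuted (F z.2) (refuteOpen K []) z.1 :=
      Primrec.or.to_comp.comp h1 (Primrec.not.to_comp.comp h2)
    exact computable_find h3.to₂ hidx
  let E : List ℕ → List ℕ → Bool := fun v σ => allRefuted (F (idx v)) (refuteOpen K σ) v
  have hE : Computable₂ E :=
    computable_allRefuted hF hK (hidxc.comp Computable.fst) Computable.snd Computable.fst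
  -- Row `t` of the output is the jump decided with the information in the input prefix of length
  -- `t`.
  have hg : Computable₂ fun (v : List ℕ) (c : ℕ) => decidedJump (E v) c.unpair.2 :=
    (computable_decidedJump hE).comp Computable.fst
      (Computable.snd.comp (Computable.unpair.comp Computable.snd))
  refine ⟨_, computablePFun_of_prefix hg (Computable.fst.comp Computable.unpair),
    fun p hp => ⟨_, Part.mem_some _, ?_⟩⟩
  have hnil : ∀ i, survivors (F i) (refuteOpen K []) p = survivors (F i) K p := by
    intro i
    simp [survivors_refuteOpen]
  have hmono := fun σ => hKm.refuteOpen σ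
  obtain ⟨i, hi, hmin⟩ : ∃ i, (survivors (F i) K p).Nonempty ∧
      ∀ j < i, survivors (F j) K p = ∅ :=
    ⟨Nat.find hp, Nat.find_spec hp, fun j hj =>
      Set.not_nonempty_iff_eq_empty.1 (Nat.find_min hp hj)⟩
  -- The finitely many earlier boxes are all seen to be empty at some stage, box `i` never is, and
  -- from stage `i` on the cap does not interfere.
  have hev : ∀ᶠ t in atTop, idx (pre p t) = i := by
    have h1 : ∀ᶠ t in atTop, ∀ j ∈ Finset.range i,
        allRefuted (F j) (refuteOpen K []) (pre p t) = true := by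
      refine (Filter.eventually_all_finset _).2 fun j hj => ?_
      filter_upwards [eventually_allRefuted_iff (hF0 j) (hmono []) p] with t ht
      exact ht.2 ((hnil j).trans (hmin j (Finset.mem_range.1 hj)))
    filter_upwards [h1, eventually_allRefuted_iff (hF0 i) (hmono []) p,
      eventually_ge_atTop i] with t h1 h2 h3
    refine (Nat.find_eq_iff (hidx (pre p t))).2 ⟨?_, fun j hj => ?_⟩
    · rw [hnil] at h2
      have : ¬ allRefuted (F i) (refuteOpen K []) (pre p t) = true := fun h =>
        hi.ne_empty (h2.1 h)
      simp [this]
    · have := h1 j (Finset.mem_range.2 hj)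
      simp [this]
      omega
  let E' : List ℕ → Bool := fun σ => decide (survivors (F i) (refuteOpen K σ) p = ∅)
  have hEE : ∀ σ, ∀ᶠ t in atTop, E (pre p t) σ = E' σ := by
    intro σ
    filter_upwards [hev, eventually_allRefuted_iff (hF0 i) (hmono σ) p] with t h1 h2
    simp only [E, E', h1]
    rw [Bool.eq_iff_iff, h2, decide_eq_true_iff]
  obtain ⟨r, hr, hrj⟩ := exists_jump_eq_decidedJump (isCompact_survivors (F i) K p) hi
    (E := E') fun σ => by simp only [E', decide_eq_true_iff, survivors_refuteOpen]
  refine ⟨r, Part.mem_bind_iff.2 ⟨decidedJump E', ?_, (mem_jumpInv _ _).2 hrj⟩, i, hr⟩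
  rw [mem_limMap, tendsto_pi_nhds]
  intro n
  refine tendsto_const_nhds.congr' ?_
  filter_upwards [eventually_decidedJump_eq hEE n] with t ht
  simp [ht]

/-! ### Negative information refutes points -/

/-- The associate with prefix `v`, applied to the input prefix `w`, is seen to write a `0`. -/
def writesZero (v w : List ℕ) : Bool :=
  (List.range v.length).any fun n => (List.range (w.length + 1)).any fun k =>
    -- An associate answers `m + 1` for the value `m`, so the entry `1` announces a `0`. All shorter
    -- prefixes must have been answered by `0` for this to be the first answer.
    decide (v[Nat.pair n (Encodable.encode (w.take k))]? = some 1) &&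
      (List.range k).all fun j => decide (v[Nat.pair n (Encodable.encode (w.take j))]? = some 0)

theorem writesZero_eq_true {v w : List ℕ} : writesZero v w = true ↔
    ∃ n, ∃ k ≤ w.length, v[Nat.pair n (Encodable.encode (w.take k))]? = some 1 ∧
      ∀ j < k, v[Nat.pair n (Encodable.encode (w.take j))]? = some 0 := by
  simp only [writesZero, List.any_eq_true, List.mem_range, Bool.and_eq_true, decide_eq_true_eq,
    List.all_eq_true, Nat.lt_succ_iff]
  refine ⟨fun ⟨n, _, h⟩ => ⟨n, h⟩, fun ⟨n, k, hk, h⟩ => ⟨n, ?_, k, hk, h⟩⟩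
  obtain ⟨h1, -⟩ := List.getElem?_eq_some_iff.1 h.1
  exact (Nat.left_le_pair _ _).trans_lt h1

theorem prefixMono_writesZero : PrefixMono writesZero := by
  intro v v' w w' hv hw h
  rw [writesZero_eq_true] at h ⊢
  obtain ⟨n, k, hk, h1, h2⟩ := h
  obtain ⟨s, rfl⟩ := hv
  obtain ⟨s', rfl⟩ := hw
  have ext : ∀ i x : ℕ, v[i]? = some x → (v ++ s)[i]? = some x := by
    intro i x h
    obtain ⟨hi, -⟩ := List.getElem?_eq_some_iff.1 h
    rw [List.getElem?_append_left hi, h]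
  refine ⟨n, k, hk.trans (by simp), ?_, fun j hj => ?_⟩
  · rw [List.take_append_of_le_length hk]
    exact ext _ _ h1
  · rw [List.take_append_of_le_length (hj.le.trans hk)]
    exact ext _ _ (h2 j hj)

theorem computable_writesZero : Computable₂ writesZero := by
  have hget : ∀ b : ℕ, Computable₂ fun (z : (List ℕ × List ℕ) × ℕ) (k : ℕ) =>
      decide (z.1.1[Nat.pair z.2 (Encodable.encode (z.1.2.take k))]? = some b) := by
    intro b
    have h1 : Computable fun z : ((List ℕ × List ℕ) × ℕ) × ℕ => z.1.1.2.take z.2 :=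
      Primrec.list_take.to_comp.comp Computable.snd
        (Computable.snd.comp (Computable.fst.comp Computable.fst))
    have h2 : Computable fun z : ((List ℕ × List ℕ) × ℕ) × ℕ =>
        Nat.pair z.1.2 (Encodable.encode (z.1.1.2.take z.2)) :=
      Primrec₂.natPair.to_comp.comp (Computable.snd.comp Computable.fst) (Computable.encode.comp h1)
    have h3 : Computable fun z : ((List ℕ × List ℕ) × ℕ) × ℕ =>
        z.1.1.1[Nat.pair z.1.2 (Encodable.encode (z.1.1.2.take z.2))]? :=
      Computable.list_getElem?.comp
        (Computable.fst.comp (Computable.fst.comp Computable.fst)) h2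
    exact Primrec.eq.decide.to_comp.comp h3 (Computable.const (some b))
  have hall : Computable₂ fun (z : (List ℕ × List ℕ) × ℕ) (k : ℕ) =>
      (List.range k).all fun j =>
        decide (z.1.1[Nat.pair z.2 (Encodable.encode (z.1.2.take j))]? = some 0) :=
    computable_all (f := fun y : ((List ℕ × List ℕ) × ℕ) × ℕ => List.range y.2)
      (q := fun y j => decide
        (y.1.1.1[Nat.pair y.1.2 (Encodable.encode (y.1.1.2.take j))]? = some 0))
      (Primrec.list_range.to_comp.comp Computable.snd)
      ((hget 0).comp (Computable.fst.comp Computable.fst) Computable.snd)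
  have hand : Computable₂ fun (z : (List ℕ × List ℕ) × ℕ) (k : ℕ) =>
      decide (z.1.1[Nat.pair z.2 (Encodable.encode (z.1.2.take k))]? = some 1) &&
      (List.range k).all fun j =>
        decide (z.1.1[Nat.pair z.2 (Encodable.encode (z.1.2.take j))]? = some 0) :=
    Primrec.and.to_comp.comp (hget 1) hall
  have hr : Computable fun z : (List ℕ × List ℕ) × ℕ => List.range (z.1.2.length + 1) :=
    Primrec.list_range.to_comp.comp (Computable.succ.comp
      (Computable.list_length.comp (Computable.snd.comp Computable.fst)))
  exact computable_any (f := fun z : List ℕ × List ℕ => List.range z.1.length)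
    (Primrec.list_range.to_comp.comp (Computable.list_length.comp Computable.fst))
    (computable_any hr hand)

theorem exists_writesZero_iff {p q r : Baire} (h : q ∈ assoc p r) :
    (∃ t, writesZero (pre p t) (pre r t) = true) ↔ ∃ n, q n = 0 := by
  classical
  obtain ⟨hd, rfl⟩ := h
  change _ ↔ ∃ n, p (Nat.pair n (Encodable.encode (pre r (Nat.find (hd n))))) - 1 = 0
  simp only [writesZero_eq_true]
  have hget : ∀ {t i x : ℕ}, (pre p t)[i]? = some x → p i = x := by
    intro t i x h
    obtain ⟨hi, -⟩ := List.getElem?_eq_some_iff.1 h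
    rw [length_pre] at hi
    rw [getElem?_pre hi] at h
    exact Option.some.inj h
  constructor
  · rintro ⟨t, n, k, hk, h1, h2⟩
    rw [length_pre] at hk
    rw [take_pre, min_eq_left hk] at h1
    refine ⟨n, ?_⟩
    have : Nat.find (hd n) = k := by
      refine (Nat.find_eq_iff _).2 ⟨by rw [hget h1]; exact one_ne_zero, fun j hj => ?_⟩
      have h3 := h2 j hj
      rw [take_pre, min_eq_left (hj.le.trans hk)] at h3
      exact not_not.2 (hget h3)
    rw [this, hget h1]
  · rintro ⟨n, hn⟩
    have hs := Nat.find_spec (hd n)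
    have hm := fun j => Nat.find_min (hd n) (m := j)
    generalize Nat.find (hd n) = k at hn hs hm
    -- These are the places of `p` consulted up to the first answer; the stage is chosen beyond all
    -- of them and beyond `k`.
    let e : ℕ → ℕ := fun j => Nat.pair n (Encodable.encode (pre r j))
    have he : ∀ j ≤ k, e j < (Finset.range (k + 1)).sup e + 1 + k := fun j hj => by
      have : e j ≤ (Finset.range (k + 1)).sup e :=
        Finset.le_sup (Finset.mem_range.2 (Nat.lt_succ_of_le hj))
      omega
    refine ⟨(Finset.range (k + 1)).sup e + 1 + k, n, k, by simp, ?_, fun j hj => ?_⟩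
    · rw [take_pre, min_eq_left (Nat.le_add_left _ _), getElem?_pre (he k le_rfl)]
      exact congrArg some (le_antisymm (Nat.sub_eq_zero_iff_le.1 hn) (Nat.pos_of_ne_zero hs))
    · rw [take_pre, min_eq_left (hj.le.trans (Nat.le_add_left _ _)), getElem?_pre (he j hj.le)]
      exact congrArg some (not_not.1 (hm j hj))

theorem realizes_of_mem_negRep {X : Type u} {δ : Representation X} {p : Baire} {A : ClosedSets δ}
    (h : A ∈ (negRep δ).toPFun p) :
    Realizes δ sierpinskiRep (assoc p) fun x => {x ∈ A.1ᶜ} := by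
  obtain ⟨U, hU, rfl⟩ := (Part.mem_map_iff _).1 h
  obtain ⟨f, hf, rfl⟩ := (Part.mem_map_iff _).1 hU
  have hf' : Realizes δ sierpinskiRep (assoc p) fun x => {f.1 x} := by
    obtain ⟨hd, rfl⟩ := hf
    exact Exists.choose_spec hd
  simpa using hf'

/-- A negative-information name is an associate for the characteristic function of the complement,
so a point outside `A` is exposed by a `0` on each of its names. -/
theorem mem_iff_of_mem_negRep {X : Type u} {δ : Representation X} {p r : Baire}
    {A : ClosedSets δ} (h : A ∈ (negRep δ).toPFun p) {x : X} (hx : x ∈ δ.toPFun r) :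
    x ∈ A.1 ↔ ∀ t, writesZero (pre p t) (pre r t) = false := by
  obtain ⟨q, hq, y, hy, hyx⟩ := realizes_of_mem_negRep h r x hx ⟨_, rfl⟩
  have h1 : y = ∃ n, q n = 0 := by simpa [sierpinskiRep] using hy
  have h2 : y = (x ∈ A.1ᶜ) := hyx
  have h3 := exists_writesZero_iff hq
  rw [← h1, h2, Set.mem_compl_iff] at h3
  rw [← not_iff_not, ← h3]
  simp

/-! ### Rapidly converging sequences in compact sets -/

namespace ComputableMetricSpace

variable {X : Type u} [MetricSpace X] (S : ComputableMetricSpace X)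

theorem mem_cauchyRep {p : Baire} {x : X} : x ∈ S.cauchyRep.toPFun p ↔
    (∀ i j, j < i → dist (S.α (p i)) (S.α (p j)) < 1 / 2 ^ j) ∧
      Tendsto (fun n => S.α (p n)) atTop (𝓝 x) :=
  mem_ofRel (fun _ _ _ h h' => tendsto_nhds_unique h.2 h'.2) p x

/-- The list `l` consists of indices of points that are `ε`-close to `K` and form an
`ε`-net for `K`. -/
def IsNet (l : List ℕ) (K : Set X) (ε : ℝ) : Prop :=
  (∀ c ∈ l, ∃ y ∈ K, dist (S.α c) y < ε) ∧ ∀ x ∈ K, ∃ c ∈ l, dist (S.α c) x < ε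

theorem exists_cover {K : Set X} (hK : IsCompact K) (n : ℕ) :
    ∃ l : List (ℕ × ℕ × ℕ), (K ⊆ ⋃ t ∈ l, S.ratBall t) ∧ (∀ t ∈ l, (S.ratBall t ∩ K).Nonempty) ∧
      ∀ t ∈ l, (t.2.1 + 1) * 2 ^ n ≤ t.2.2 + 1 := by
  classical
  -- The code `(j, 0, 2 ^ n - 1)` has radius `1 / 2 ^ n`. Balls missing `K` are filtered out below,
  -- since a `κ`-name lists only balls that meet `K`.
  obtain ⟨s, hs⟩ := hK.elim_finite_subcover (fun j : ℕ => S.ratBall (j, 0, 2 ^ n - 1))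
    (fun j => Metric.isOpen_ball) (fun x _ => by
      obtain ⟨j, hj⟩ := S.dense.exists_dist_lt x
        (show (0 : ℝ) < (((0 : ℕ) : ℝ) + 1) / (((2 ^ n - 1 : ℕ) : ℝ) + 1) by positivity)
      exact Set.mem_iUnion.2 ⟨j, hj⟩)
  refine ⟨((s.filter fun j => (S.ratBall (j, 0, 2 ^ n - 1) ∩ K).Nonempty).toList.map
    fun j => (j, 0, 2 ^ n - 1)), fun x hx => ?_, fun t ht => ?_, fun t ht => ?_⟩
  · obtain ⟨j, hj, hxj⟩ := Set.mem_iUnion₂.1 (hs hx)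
    refine Set.mem_iUnion₂.2 ⟨(j, 0, 2 ^ n - 1), List.mem_map.2 ⟨j, ?_, rfl⟩, hxj⟩
    simp only [Finset.mem_toList, Finset.mem_filter]
    exact ⟨hj, x, hxj, hx⟩
  · obtain ⟨j, hj, rfl⟩ := List.mem_map.1 ht
    simp only [Finset.mem_toList, Finset.mem_filter] at hj
    exact hj.2
  · obtain ⟨j, hj, rfl⟩ := List.mem_map.1 ht
    have : 0 < 2 ^ n := by positivity
    simp only
    omega

/-- Nets of a uniformly computable sequence of compact sets are uniformly computable. -/
theorem exists_computable_net {K : ℕ → TopologicalSpace.NonemptyCompacts X} {p : ℕ → Baire}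
    (hp : Computable₂ p) (hpK : ∀ i, S.IsKappaName (p i) (K i : Set X)) :
    ∃ F : ℕ → ℕ → List ℕ, Computable₂ F ∧ ∀ i n, S.IsNet (F i n) (K i) (1 / 2 ^ n) := by
  let L : ℕ → ℕ → List (ℕ × ℕ × ℕ) := fun i m => (Encodable.decode (p i m)).getD []
  have hL : Computable₂ L :=
    Computable.option_getD (Computable.decode.comp hp) (Computable.const [])
  let fine : ℕ → ℕ × ℕ × ℕ → Bool := fun n t => decide ((t.2.1 + 1) * 2 ^ n ≤ t.2.2 + 1)
  have hfine : Computable₂ fine := by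
    have h2 : Primrec fun n : ℕ => 2 ^ n := by
      refine (Primrec.nat_rec₁ (f := fun (_ IH : ℕ) => 2 * IH) 1
        (Primrec.nat_mul.comp (Primrec.const 2) Primrec.snd)).of_eq fun n => ?_
      induction n with
      | zero => rfl
      | succ n ih => simp only [pow_succ', ← ih]
    have h3 : Primrec fun z : ℕ × ℕ × ℕ × ℕ => (z.2.2.1 + 1) * 2 ^ z.1 :=
      Primrec.nat_mul.comp (Primrec.succ.comp (Primrec.fst.comp (Primrec.snd.comp Primrec.snd)))
        (h2.comp Primrec.fst)
    have h4 : Primrec fun z : ℕ × ℕ × ℕ × ℕ => z.2.2.2 + 1 :=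
      Primrec.succ.comp (Primrec.snd.comp (Primrec.snd.comp Primrec.snd))
    exact (Primrec.nat_le.decide.comp h3 h4).to_comp
  have hcode : ∀ i m, Encodable.encode (L i m) = p i m ∧
      ((K i : Set X) ⊆ ⋃ t ∈ L i m, S.ratBall t) ∧
      ∀ t ∈ L i m, (S.ratBall t ∩ (K i : Set X)).Nonempty := by
    intro i m
    have : p i m ∈ Set.range (p i) := ⟨m, rfl⟩
    rw [hpK i] at this
    obtain ⟨l, hl, h⟩ := this
    have hLl : L i m = l := by
      simp only [L, ← hl, Encodable.encodek, Option.getD_some]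
    rw [hLl]
    exact ⟨hl, h⟩
  -- A `κ`-name lists all admissible covers, so the search for one with all radii at most `1 / 2 ^
  -- n` succeeds. The centres of its balls form the net.
  have hex : ∀ x : ℕ × ℕ, ∃ m, ((L x.1 m).all (fine x.2)) = true := by
    rintro ⟨i, n⟩
    obtain ⟨l, h1, h2, h3⟩ := S.exists_cover (K i).isCompact n
    have : Encodable.encode l ∈ Set.range (p i) := by
      rw [hpK i]
      exact ⟨l, rfl, h1, h2⟩
    obtain ⟨m, hm⟩ := this
    have hLl : L i m = l := Encodable.encode_injective ((hcode i m).1.trans hm)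
    refine ⟨m, ?_⟩
    rw [hLl]
    simpa [fine] using h3
  have hc : Computable₂ fun (x : ℕ × ℕ) (m : ℕ) => (L x.1 m).all (fine x.2) :=
    computable_all (f := fun z : (ℕ × ℕ) × ℕ => L z.1.1 z.2) (q := fun z t => fine z.1.2 t)
      (hL.comp (Computable.fst.comp Computable.fst) Computable.snd)
      (hfine.comp (Computable.snd.comp (Computable.fst.comp Computable.fst)) Computable.snd)
  refine ⟨fun i n => (L i (Nat.find (hex (i, n)))).map Prod.fst, ?_, fun i n => ?_⟩
  · exact computable_map (f := fun x : ℕ × ℕ => L x.1 (Nat.find (hex x)))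
      (q := fun _ t => t.1) (hL.comp Computable.fst (computable_find hc hex))
      (Computable.fst.comp Computable.snd)
  · obtain ⟨-, hcov, hmeet⟩ := hcode i (Nat.find (hex (i, n)))
    have hsmall := Nat.find_spec (hex (i, n))
    change S.IsNet ((L i (Nat.find (hex (i, n)))).map Prod.fst) _ _
    simp only at hsmall
    generalize L i (Nat.find (hex (i, n))) = l at hcov hmeet hsmall ⊢
    simp only [List.all_eq_true, fine, decide_eq_true_eq] at hsmall
    have hrad : ∀ t ∈ l, ((t.2.1 : ℝ) + 1) / ((t.2.2 : ℝ) + 1) ≤ 1 / 2 ^ n := by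
      intro t ht
      rw [div_le_div_iff₀ (by positivity) (by positivity), one_mul]
      exact_mod_cast hsmall t ht
    constructor
    · intro c hc
      obtain ⟨t, ht, rfl⟩ := List.mem_map.1 hc
      obtain ⟨y, hy, hyK⟩ := hmeet t ht
      refine ⟨y, hyK, ?_⟩
      rw [dist_comm]
      exact (Metric.mem_ball.1 hy).trans_le (hrad t ht)
    · intro x hx
      obtain ⟨t, ht, hxt⟩ := Set.mem_iUnion₂.1 (hcov hx)
      refine ⟨t.1, List.mem_map.2 ⟨t, ht, rfl⟩, ?_⟩
      rw [dist_comm]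
      exact (Metric.mem_ball.1 hxt).trans_le (hrad t ht)

/-- With respect to the distance approximations `a`, the word `w` is seen not to be the beginning
of a rapidly converging sequence. -/
def seenFar (a : ℕ × ℕ × ℕ → ℕ) (w : List ℕ) : Bool :=
  (List.range w.length).any fun n => (List.range n).any fun m =>
    -- The approximation errs by at most `1 / 2 ^ (m + 5)`. A value of at most `7` therefore bounds
    -- the distance by `8 / 2 ^ (m + 5)`, a quarter of `1 / 2 ^ m`, while distances below `6 / 2 ^
    -- (m + 5)` never exceed the threshold.
    decide (7 < a (w.getD n 0, w.getD m 0, m + 5))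

theorem seenFar_mono {a : ℕ × ℕ × ℕ → ℕ} {w w' : List ℕ} (hw : w <+: w')
    (h : seenFar a w = true) : seenFar a w' = true := by
  simp only [seenFar, List.any_eq_true, List.mem_range, decide_eq_true_eq] at h ⊢
  obtain ⟨n, hn, m, hm, h⟩ := h
  refine ⟨n, hn.trans_le hw.length_le, m, hm, ?_⟩
  obtain ⟨s, rfl⟩ := hw
  rwa [List.getD_append _ _ _ _ hn, List.getD_append _ _ _ _ (hm.trans hn)]

theorem computable_seenFar {a : ℕ × ℕ × ℕ → ℕ} (ha : Computable a) :
    Computable (seenFar a) := by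
  have h1 : Computable fun z : (List ℕ × ℕ) × ℕ =>
      a (z.1.1.getD z.1.2 0, z.1.1.getD z.2 0, z.2 + 5) := by
    have hw : Computable fun z : (List ℕ × ℕ) × ℕ => z.1.1 := Computable.fst.comp Computable.fst
    have hx : Computable fun z : (List ℕ × ℕ) × ℕ => z.1.1.getD z.1.2 0 :=
      (Primrec.list_getD 0).to_comp.comp hw (Computable.snd.comp Computable.fst)
    have hy : Computable fun z : (List ℕ × ℕ) × ℕ => z.1.1.getD z.2 0 :=
      (Primrec.list_getD 0).to_comp.comp hw Computable.snd
    have hk : Computable fun z : (List ℕ × ℕ) × ℕ => z.2 + 5 :=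
      Primrec.nat_add.to_comp.comp Computable.snd (Computable.const 5)
    exact ha.comp (hx.pair (hy.pair hk))
  have h2 : Computable₂ fun (z : List ℕ × ℕ) (m : ℕ) =>
      decide (7 < a (z.1.getD z.2 0, z.1.getD m 0, m + 5)) :=
    Primrec.nat_lt.decide.to_comp.comp (Computable.const 7) h1
  exact computable_any (f := fun w : List ℕ => List.range w.length)
    (Primrec.list_range.to_comp.comp Computable.list_length)
    (computable_any (f := fun z : List ℕ × ℕ => List.range z.2)
      (Primrec.list_range.to_comp.comp Computable.snd) h2)

theorem seenFar_pre {a : ℕ × ℕ × ℕ → ℕ} {r : Baire} :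
    (∀ t, seenFar a (pre r t) = false) ↔ ∀ n, ∀ m < n, a (r n, r m, m + 5) ≤ 7 := by
  have hget : ∀ {t i}, i < t → (pre r t).getD i 0 = r i := by
    intro t i hi
    rw [List.getD_eq_getElem?_getD, getElem?_pre hi, Option.getD_some]
  simp only [← Bool.not_eq_true, seenFar, List.any_eq_true, List.mem_range, decide_eq_true_eq,
    length_pre, not_exists, not_and, not_lt]
  constructor
  · intro h n m hm
    have := h (n + 1) n (Nat.lt_succ_self n) m hm
    rwa [hget (Nat.lt_succ_self n), hget (hm.trans (Nat.lt_succ_self n))] at this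
  · intro h t n hn m hm
    rw [hget hn, hget (hm.trans hn)]
    exact h n m hm

variable {S}

/-- Compactness of `K` replaces completeness of `X`: nearby points of `K` have a convergent
subsequence, and a Cauchy sequence converges to its subsequential limit. -/
theorem exists_mem_cauchyRep {K : Set X} (hK : IsCompact K) {F : ℕ → List ℕ}
    (hF : ∀ n, S.IsNet (F n) K (1 / 2 ^ n)) {r : Baire} (hr : r ∈ box F)
    (hd : ∀ i j, j < i → dist (S.α (r i)) (S.α (r j)) < 1 / 2 ^ j) :
    ∃ x ∈ K, x ∈ S.cauchyRep.toPFun r := by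
  choose y hyK hy using fun n => (hF n).1 (r n) (hr n)
  obtain ⟨x, hx, φ, hφ, hlim⟩ := hK.tendsto_subseq hyK
  refine ⟨x, hx, S.mem_cauchyRep.2 ⟨hd, ?_⟩⟩
  have h0 : Tendsto (fun n : ℕ => (1 : ℝ) / 2 ^ n) atTop (𝓝 0) := by
    simpa [one_div] using tendsto_pow_atTop_nhds_zero_of_lt_one (r := (1 / 2 : ℝ))
      (by norm_num) (by norm_num)
  have hc : CauchySeq fun n => S.α (r n) := by
    refine cauchySeq_of_le_tendsto_0' (fun n : ℕ => (1 : ℝ) / 2 ^ n) (fun n m hnm => ?_) h0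
    rcases hnm.eq_or_lt with rfl | hnm
    · simp only [dist_self]
      positivity
    · rw [dist_comm]
      exact (hd m n hnm).le
  refine tendsto_nhds_of_cauchySeq_of_subseq hc hφ.tendsto_atTop ?_
  refine (tendsto_iff_of_dist ?_).2 hlim
  exact squeeze_zero (fun _ => dist_nonneg) (fun n => (hy (φ n)).le)
    (h0.comp hφ.tendsto_atTop)

/-- Closed choice on a computable `K_σ`-space is low computable. -/
theorem IsComputableKSigma.lowComputable_closedChoice (hS : S.IsComputableKSigma) :
    LowComputable (negRep S.cauchyRep) S.cauchyRep (closedChoice S.cauchyRep) := by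
  obtain ⟨K, ⟨p, hp, hpK⟩, hKX⟩ := hS
  obtain ⟨a, ha, had⟩ := S.computable_dist
  obtain ⟨F', hF', hnet'⟩ := S.exists_computable_net hp hpK
  -- Shifting by `3` puts net points close to a common `x` at distance below `1 / 2 ^ (m + 4) + 1 /
  -- 2 ^ (m + 3) = 6 / 2 ^ (m + 5)` for `m < n`, safely under the threshold of `seenFar`.
  let F : ℕ → ℕ → List ℕ := fun i n => F' i (n + 3)
  have hF : Computable₂ F :=
    hF'.comp Computable.fst (Primrec.nat_add.to_comp.comp Computable.snd (Computable.const 3))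
  have hnet : ∀ i n, S.IsNet (F i n) (K i) (1 / 2 ^ (n + 3)) := fun i n => hnet' i (n + 3)
  have hpow : ∀ n m : ℕ, m ≤ n → (1 : ℝ) / 2 ^ n ≤ 1 / 2 ^ m := fun n m h =>
    one_div_le_one_div_of_le (by positivity) (pow_le_pow_right₀ (by norm_num) h)
  have hF0 : ∀ i n, F i n ≠ [] := by
    intro i n h
    obtain ⟨x, hx⟩ := (K i).nonempty
    obtain ⟨c, hc, -⟩ := (hnet i n).2 x hx
    simp [h] at hc
  obtain ⟨M, hM, hMs⟩ := uniform_low_basis hF hF0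
    (K := fun v w => seenFar a w || writesZero v w)
    (Primrec.or.to_comp.comp ((computable_seenFar ha).comp Computable.snd) computable_writesZero)
    (fun v v' w w' hv hw h => by
      rw [Bool.or_eq_true] at h ⊢
      exact h.imp (seenFar_mono hw) (prefixMono_writesZero v v' w w' hv hw))
  refine ⟨M, hM, fun q A hA hne => ?_⟩
  have hsurv : ∀ i r, r ∈ survivors (F i) (fun v w => seenFar a w || writesZero v w) q ↔
      r ∈ box (F i) ∧ (∀ n, ∀ m < n, a (r n, r m, m + 5) ≤ 7) ∧
        ∀ t, writesZero (pre q t) (pre r t) = false := by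
    intro i r
    simp only [survivors, Set.mem_ofPred_eq, Bool.or_eq_false_iff, forall_and, seenFar_pre]
  -- A point of `A` lies in some `K i`; choosing net points close to it gives a name that is never
  -- refuted.
  have hex : ∃ i, (survivors (F i) (fun v w => seenFar a w || writesZero v w) q).Nonempty := by
    obtain ⟨x, hx⟩ := hne
    obtain ⟨i, hi⟩ := Set.mem_iUnion.1 (hKX.symm ▸ Set.mem_univ x : x ∈ ⋃ i, (K i : Set X))
    choose r hrF hrx using fun n => (hnet i n).2 x hi
    have hd : ∀ n m, m < n → dist (S.α (r n)) (S.α (r m)) < 6 / 2 ^ (m + 5) := by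
      intro n m hm
      have h1 := dist_triangle_right (S.α (r n)) (S.α (r m)) x
      have h2 := hpow (n + 3) (m + 4) (by omega)
      have h3 : (1 : ℝ) / 2 ^ (m + 4) + 1 / 2 ^ (m + 3) = 6 / 2 ^ (m + 5) := by
        simp only [pow_add]
        field_simp
        norm_num
      have := hrx n
      have := hrx m
      linarith
    have hname : x ∈ S.cauchyRep.toPFun r := by
      refine S.mem_cauchyRep.2 ⟨fun n m hm => (hd n m hm).trans ?_, ?_⟩
      · rw [pow_add, div_lt_div_iff₀ (by positivity) (by positivity)]
        have : (0 : ℝ) < 2 ^ m := by positivity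
        linarith
      · rw [tendsto_iff_dist_tendsto_zero]
        have h0 : Tendsto (fun n : ℕ => ((1 : ℝ) / 2) ^ n) atTop (𝓝 0) :=
          tendsto_pow_atTop_nhds_zero_of_lt_one (by norm_num) (by norm_num)
        refine squeeze_zero (fun _ => dist_nonneg) (fun n => ?_) h0
        rw [div_pow, one_pow]
        exact (hrx n).le.trans (hpow _ _ (by omega))
    refine ⟨i, r, (hsurv i r).2 ⟨hrF, fun n m hm => ?_, (mem_iff_of_mem_negRep hA hname).1 hx⟩⟩
    have h1 := (abs_le.1 (had (r n) (r m) (m + 5))).1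
    have h2 : (a (r n, r m, m + 5) : ℝ) / 2 ^ (m + 5) < 8 / 2 ^ (m + 5) := by
      have h3 := hd n m hm
      have h4 : (6 : ℝ) / 2 ^ (m + 5) + 1 / 2 ^ (m + 5) < 8 / 2 ^ (m + 5) := by
        rw [← add_div]
        gcongr
        norm_num
      linarith
    rw [div_lt_div_iff_of_pos_right (by positivity)] at h2
    have : a (r n, r m, m + 5) < 8 := by exact_mod_cast h2
    omega
  obtain ⟨z, hz, r, hr, i, hri⟩ := hMs q hex
  rw [hsurv] at hri
  obtain ⟨hbox, hclose, hzero⟩ := hri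
  have hnet₀ : ∀ n, S.IsNet (F i n) (K i) (1 / 2 ^ n) := by
    refine fun n => ⟨fun c hc => ?_, fun x hx => ?_⟩
    · obtain ⟨y, hy, hd⟩ := (hnet i n).1 c hc
      exact ⟨y, hy, hd.trans_le (hpow _ _ (by omega))⟩
    · obtain ⟨c, hc, hd⟩ := (hnet i n).2 x hx
      exact ⟨c, hc, hd.trans_le (hpow _ _ (by omega))⟩
  have hfast : ∀ n m, m < n → dist (S.α (r n)) (S.α (r m)) < 1 / 2 ^ m := by
    intro n m hm
    have h1 := (abs_le.1 (had (r n) (r m) (m + 5))).2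
    have h2 : (a (r n, r m, m + 5) : ℝ) ≤ 7 := by exact_mod_cast hclose n m hm
    have h3 : (a (r n, r m, m + 5) : ℝ) / 2 ^ (m + 5) ≤ 7 / 2 ^ (m + 5) := by gcongr
    have h4 : (7 : ℝ) / 2 ^ (m + 5) + 1 / 2 ^ (m + 5) = 1 / 4 * (1 / 2 ^ m) := by
      rw [pow_add]
      field_simp
      norm_num
    have h5 : (0 : ℝ) < 1 / 2 ^ m := by positivity
    linarith
  -- The survivor is a genuine name, so the absence of a `0` now means that its point belongs to
  -- `A`.
  obtain ⟨x, -, hx⟩ := exists_mem_cauchyRep (K i).isCompact hnet₀ hbox hfast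
  exact ⟨z, hz, x, mem_low_toPFun.2 ⟨r, hr, hx⟩, (mem_iff_of_mem_negRep hA hx).2 hzero⟩

end ComputableMetricSpace

end TTE

theorem mainTheorem8 :
    (∀ (X : Type u) (Y : Type v) (δX : TTE.Representation X) (δY : TTE.Representation Y)
      (f : X → Set Y),
      TTE.LowComputable δX δY f ↔
        TTE.StrongWeihrauchLE δX δY f TTE.baireRep TTE.baireRep TTE.lowMap) ∧
    (∀ (X : Type w) [MetricSpace X] (S : TTE.ComputableMetricSpace X),
      S.IsComputableKSigma →
        TTE.LowComputable (TTE.negRep S.cauchyRep) S.cauchyRep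
          (TTE.closedChoice S.cauchyRep)) :=
  ⟨fun _ _ δX δY f => TTE.lowComputable_iff δX δY f,
    fun _ _ _ hS => hS.lowComputable_closedChoice⟩
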